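/- Let $G$ be a group and let $A\le \mathrm{Aut}(G)$ be a group of automorphisms of $G$ that is normalized by $\mathrm{Inn}(G)$ and is finite-by-hypercentral, i.e. $A$ has a finite normal subgroup $F$ such that $A/F$ is hypercentral (some term of the transfinite upper central series of $A/F$ equals $A/F$). By an ascending $G$-series of a normal subgroup $K$ of $G$ we mean a family $(S_\beta)_{\beta\le\tau}$ of normal subgroups of $G$, indexed by the ordinals up to some ordinal $\tau$, with $S_0=1$, $S_\tau=K$, $S_\beta\le S_\gamma$ whenever $\beta\le\gamma$, and $S_\lambda=\bigcup_{\beta<\lambda}S_\beta$ for limit ordinals $\lambda\le\tau$; its factors are the quotients $S_{\beta+1}/S_\beta$ with $\beta<\tau$. We say that $A$ acts trivially on the factor $S_{\beta+1}/S_\beta$ if $g^{-1}a(g)\in S_\beta$ for all $g\in S_{\beta+1}$ and $a\in A$, and that $A$ stabilizes the series if it acts trivially on all its factors. A subgroup $H$ of $G$ is an $A$-subgroup if $a(H)=H$ for all $a\in A$; if it is also normal in $G$, then $A$ acts on $G/H$ by $a(gH)=a(g)H$, and ascending $G$-series of $G/H$ are the ascending series, in the above sense, consisting of normal subgroups of $G/H$.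 Suppose that $G$ has an ascending $G$-series (from $1$ to $G$) such that finitely many of its factors are finite and $A$ acts trivially on all the other factors. (These finitely many factors need not be all the finite factors of the series.) Then: (i) there is a normal $A$-subgroup $G_0$ of finite index in $G$ such that $A$ stabilizes an ascending $G$-series of $G_0$; (ii) there is a finite normal $A$-subgroup $L$ of $G$ such that $A$ stabilizes an ascending $G$-series of $G/L$. -/

import Mathlib

universe u

/-- The next step of the upper central series: for a normal subgroup `H` of `G`, the (normal)
subgroup `K` with `K / H = Z(G / H)`. -/
def centerStep {G : Type u} [Group G] (H : {H : Subgroup G // H.Normal}) :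
    {H : Subgroup G // H.Normal} :=
  haveI := H.2
  ⟨(Subgroup.center (G ⧸ H.1)).comap (QuotientGroup.mk' H.1), inferInstance⟩

/-- The transfinite upper central series, each term bundled with its normality:
`Z_0 = 1`, `Z_{α+1} / Z_α = Z(G / Z_α)`, and `Z_l` is the join (equivalently, as the terms form
a chain, the union) of the earlier terms when `l` is a limit ordinal. -/
noncomputable def transfiniteCenterAux (G : Type u) [Group G] (α : Ordinal.{u}) :
    {H : Subgroup G // H.Normal} :=
  Ordinal.limitRecOn α ⟨⊥, inferInstance⟩ (fun _ H => centerStep H)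
    (fun l _ ih => ⟨⨆ b : Set.Iio l, (ih b.1 b.2).1,
      haveI : ∀ b : Set.Iio l, (ih b.1 b.2).1.Normal := fun b => (ih b.1 b.2).2
      Subgroup.iSup_normal _⟩)

/-- `Z_α(G)`, the `α`-th term of the transfinite upper central series of `G`. -/
noncomputable def transfiniteCenter (G : Type u) [Group G] (α : Ordinal.{u}) : Subgroup G :=
  (transfiniteCenterAux G α).1

/-- `G` is hypercentral: some term of its transfinite upper central series is all of `G`
(that is, `G` coincides with its hypercenter, the last term of that series). -/
def IsHypercentral (G : Type u) [Group G] : Prop :=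
  ∃ α : Ordinal.{u}, transfiniteCenter G α = ⊤

/-- `G` has a finite normal subgroup with hypercentral quotient. -/
def IsFiniteByHypercentral (G : Type u) [Group G] : Prop :=
  ∃ (L : Subgroup G) (_ : L.Normal), Finite L ∧ IsHypercentral (G ⧸ L)

/-- The subgroup `H` of `G` is invariant under the group `A` of automorphisms of `G`. -/
def IsInvariantUnder {G : Type u} [Group G] (A : Subgroup (MulAut G)) (H : Subgroup G) : Prop :=
  ∀ a ∈ A, H.map (a : G ≃* G).toMonoidHom = H

/-- The action of `A` on `G / L`, for a normal `A`-invariant subgroup `L`; the automorphism `a`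
sends the coset `g L` to `(a g) L`. -/
def quotientAction {G : Type u} [Group G] (A : Subgroup (MulAut G)) (L : Subgroup G) [L.Normal]
    (hL : IsInvariantUnder A L) : A →* MulAut (G ⧸ L) where
  toFun a := QuotientGroup.congr L L a.1 (hL a.1 a.2)
  map_one' := by
    ext x
    induction x using QuotientGroup.induction_on with
    | H g => rfl
  map_mul' a b := by
    ext x
    induction x using QuotientGroup.induction_on with
    | H g => rfl

/-- `(S β)`, for `β ≤ τ`, is an ascending series from `1` to `K` all of whose terms are normal
subgroups of `G`, with unions at limit ordinals. Values `S β` with `β > τ` are irrelevant, and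
repetitions are allowed. -/
structure IsAscendingNormalSeries {G : Type u} [Group G] (S : Ordinal.{u} → Subgroup G)
    (τ : Ordinal.{u}) (K : Subgroup G) : Prop where
  normal : ∀ β ≤ τ, (S β).Normal
  mono : ∀ β γ, β ≤ γ → γ ≤ τ → S β ≤ S γ
  zero : S 0 = ⊥
  last : S τ = K
  limit : ∀ l ≤ τ, Order.IsSuccLimit l → ∀ x, x ∈ S l ↔ ∃ β < l, x ∈ S β

/-- The factor `S (β + 1) / S β` is finite. -/
def FactorFinite {G : Type u} [Group G] (S : Ordinal.{u} → Subgroup G) (β : Ordinal.{u}) : Prop :=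
  Finite (S (β + 1) ⧸ (S β).subgroupOf (S (β + 1)))

/-- `B`, acting on `G` by automorphisms through `φ`, acts trivially on the factor
`S (β + 1) / S β`: every `g ∈ S (β + 1)` has `g (S β) = (b g) (S β)` for all `b`. -/
def ActsTriviallyOnFactor {G : Type u} [Group G] {B : Type u} [Group B] (φ : B →* MulAut G)
    (S : Ordinal.{u} → Subgroup G) (β : Ordinal.{u}) : Prop :=
  ∀ b : B, ∀ g ∈ S (β + 1), g⁻¹ * φ b g ∈ S β

/-- `B`, acting on `G` through `φ`, stabilizes the series `(S β)`, `β ≤ τ`: it acts trivially on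
every factor. -/
def Stabilizes {G : Type u} [Group G] {B : Type u} [Group B] (φ : B →* MulAut G)
    (S : Ordinal.{u} → Subgroup G) (τ : Ordinal.{u}) : Prop :=
  ∀ β < τ, ActsTriviallyOnFactor φ S β

/-!
For a group `B` of operators on `G`, the analogue of the hypercenter is the hyperfixed subgroup
modulo a normal admissible subgroup `L`: it is exhausted by an ascending normal series starting at
`L` with trivial action on the factors. Conclusion (i) says that the hyperfixed subgroup modulo `1`
has finite index, and (ii) that the hyperfixed subgroup modulo some finite `L` is all of `G`.

Let `R` be a smallest finite normal subgroup of `A` with hypercentral quotient. Minimality forces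
`R` to fix, modulo `L`, every element of the hyperfixed subgroup modulo `L`. It also makes `R`
invariant under every automorphism of `A`, hence under conjugation by inner automorphisms of `G`.

Suppose that the hyperfixed subgroup has finite index in the normal admissible subgroup `K`. As
`[K, A]` consists of elements inducing operators in `A`, and `A / R` is hypercentral, `K` is
hyperfixed modulo the subgroup `M` of its elements that induce operators in `R`. Since `R` is
finite, `M` is central-by-finite, and Schur's theorem reduces the problem to a commutative group
`X`. There `[X, R]` is finite; modulo it the operators act through a hypercentral group, and a
Fitting decomposition with respect to the endomorphism `x ↦ x⁻¹ a(x)`, for `a` central modulo the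
operators that act trivially on an irreducible factor, supplements the hyperfixed subgroup by a
finite admissible subgroup. Hence `K` is finite-by-hyperfixed. This removes finite factors one at
a time while climbing along the given series, which proves (ii).

For (i), divide out the hyperfixed subgroup, so that no operator-fixed elements remain. The
elements fixed by `R` and centralizing `L` form a subgroup of finite index. It lies in `L`, because
those of them that are fixed modulo `L` form a commutative group on which `A` acts hypercentrally
and without fixed points; so `G` is finite.
-/

section Operators

variable {G B : Type*} [Group G] [Group B]

/-- A subgroup that is mapped into itself by a group `B` of operators acting through `φ`. -/
def IsAdmissible (φ : B →* MulAut G) (H : Subgroup G) : Prop :=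
  ∀ b, ∀ x ∈ H, φ b x ∈ H

/-- A normal subgroup that is mapped into itself by the operators. -/
structure IsNormalAdmissible (φ : B →* MulAut G) (N : Subgroup G) : Prop where
  normal : N.Normal
  admissible : IsAdmissible φ N

/-- The operators form a group of automorphisms normalized by the inner automorphisms. -/
def InnNormalized (φ : B →* MulAut G) : Prop :=
  ∀ g b, MulAut.conj g * φ b * (MulAut.conj g)⁻¹ ∈ φ.range

/-- The operators have no nontrivial fixed point modulo `N`. -/
def IsFixedClosed (φ : B →* MulAut G) (N : Subgroup G) : Prop :=
  ∀ x, (∀ b, x⁻¹ * φ b x ∈ N) → x ∈ N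

/-- The subgroup of the elements fixed by the operators modulo `N`. Taking the subgroup generated
by these elements, which already form a subgroup when `N` is normal, makes this a monotone
function on the lattice of all subgroups. -/
def fixedModulo (φ : B →* MulAut G) (N : Subgroup G) : Subgroup G :=
  Subgroup.closure {x | ∀ b, x⁻¹ * φ b x ∈ N}

/-- The analogue of the preimage of the hypercenter of `G / L`: the least normal admissible
subgroup containing `L` modulo which the operators have no nontrivial fixed point. -/
def hyperfixedModulo (φ : B →* MulAut G) (L : Subgroup G) : Subgroup G :=
  sInf {N | IsNormalAdmissible φ N ∧ IsFixedClosed φ N ∧ L ≤ N}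

variable {φ : B →* MulAut G} {H K L N : Subgroup G}

theorem IsAdmissible.inv_mul_apply_mem (hH : IsAdmissible φ H) {x : G} (hx : x ∈ H) (b : B) :
    x⁻¹ * φ b x ∈ H :=
  H.mul_mem (H.inv_mem hx) (hH b x hx)

theorem isAdmissible_of_inv_mul_apply_mem (h : ∀ x ∈ H, ∀ b, x⁻¹ * φ b x ∈ H) :
    IsAdmissible φ H := fun b x hx => by
  simpa using H.mul_mem hx (h x hx b)

theorem InnNormalized.exists_apply_eq (hφ : InnNormalized φ) (g : G) (b : B) :
    ∃ c, ∀ x, φ c x = g * φ b (g⁻¹ * x * g) * g⁻¹ := by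
  obtain ⟨c, hc⟩ := hφ g b
  exact ⟨c, fun x => by simp [hc]⟩

namespace IsNormalAdmissible

theorem conj_mem (hN : IsNormalAdmissible φ N) {x : G} (hx : x ∈ N) (g : G) : g * x * g⁻¹ ∈ N :=
  hN.normal.conj_mem x hx g

theorem bot : IsNormalAdmissible φ (⊥ : Subgroup G) :=
  ⟨inferInstance, fun b x hx => by simp_all⟩

theorem top : IsNormalAdmissible φ (⊤ : Subgroup G) :=
  ⟨inferInstance, fun _ _ _ => Subgroup.mem_top _⟩

theorem sInf {c : Set (Subgroup G)} (h : ∀ N ∈ c, IsNormalAdmissible φ N) :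
    IsNormalAdmissible φ (sInf c) where
  normal := ⟨fun x hx g => by
    rw [Subgroup.mem_sInf] at hx ⊢
    exact fun N hN => (h N hN).conj_mem (hx N hN) g⟩
  admissible b x hx := by
    rw [Subgroup.mem_sInf] at hx ⊢
    exact fun N hN => (h N hN).admissible b x (hx N hN)

theorem inf (hK : IsNormalAdmissible φ K) (hN : IsNormalAdmissible φ N) :
    IsNormalAdmissible φ (K ⊓ N) where
  normal := by
    have := hK.normal
    have := hN.normal
    infer_instance
  admissible b x hx := ⟨hK.admissible b x hx.1, hN.admissible b x hx.2⟩

theorem closure {s : Set G} (h₁ : ∀ x ∈ s, ∀ g, g * x * g⁻¹ ∈ s) (h₂ : ∀ x ∈ s, ∀ b, φ b x ∈ s) :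
    IsNormalAdmissible φ (Subgroup.closure s) where
  normal := ⟨fun x hx g => by
    have : Subgroup.closure s ≤ (Subgroup.closure s).comap (MulAut.conj g).toMonoidHom :=
      (Subgroup.closure_le _).2 fun y hy => Subgroup.subset_closure (h₁ y hy g)
    exact this hx⟩
  admissible b x hx := by
    have : Subgroup.closure s ≤ (Subgroup.closure s).comap (φ b).toMonoidHom :=
      (Subgroup.closure_le _).2 fun y hy => Subgroup.subset_closure (h₂ y hy b)
    exact this hx

theorem sSup_of_isChain {c : Set (Subgroup G)} (hne : c.Nonempty) (hc : IsChain (· ≤ ·) c)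
    (h : ∀ N ∈ c, IsNormalAdmissible φ N) : IsNormalAdmissible φ (sSup c) where
  normal := ⟨fun x hx g => by
    rw [Subgroup.mem_sSup_of_directedOn hne hc.directedOn] at hx ⊢
    obtain ⟨N, hN, hx⟩ := hx
    exact ⟨N, hN, (h N hN).conj_mem hx g⟩⟩
  admissible b x hx := by
    rw [Subgroup.mem_sSup_of_directedOn hne hc.directedOn] at hx ⊢
    obtain ⟨N, hN, hx⟩ := hx
    exact ⟨N, hN, (h N hN).admissible b x hx⟩

end IsNormalAdmissible

theorem mem_fixedModulo (hN : N.Normal) {x : G} :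
    x ∈ fixedModulo φ N ↔ ∀ b, x⁻¹ * φ b x ∈ N := by
  refine ⟨fun hx => ?_, fun hx => Subgroup.subset_closure hx⟩
  induction hx using Subgroup.closure_induction with
  | mem _ h => exact h
  | one => simp
  | mul x y _ _ hx hy =>
    intro b
    have : (x * y)⁻¹ * φ b (x * y) = y⁻¹ * (x⁻¹ * φ b x) * y⁻¹⁻¹ * (y⁻¹ * φ b y) := by
      rw [map_mul]; group
    rw [this]
    exact N.mul_mem (hN.conj_mem _ (hx b) y⁻¹) (hy b)
  | inv x _ hx =>
    intro b
    have : (x⁻¹)⁻¹ * φ b x⁻¹ = x * (x⁻¹ * φ b x)⁻¹ * x⁻¹ := by rw [map_inv]; group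
    rw [this]
    exact hN.conj_mem _ (N.inv_mem (hx b)) x

theorem mem_fixedModulo_bot {x : G} : x ∈ fixedModulo φ ⊥ ↔ ∀ b, φ b x = x := by
  simp_rw [mem_fixedModulo (inferInstance : (⊥ : Subgroup G).Normal), Subgroup.mem_bot,
    inv_mul_eq_one, eq_comm]

theorem fixedModulo_mono : Monotone (fixedModulo φ) := fun _ _ h =>
  Subgroup.closure_mono fun _ hx b => h (hx b)

theorem IsAdmissible.le_fixedModulo (hH : IsAdmissible φ H) : H ≤ fixedModulo φ H := fun _ hx =>
  Subgroup.subset_closure fun b => hH.inv_mul_apply_mem hx b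

theorem isFixedClosed_iff (hN : N.Normal) : IsFixedClosed φ N ↔ fixedModulo φ N ≤ N :=
  ⟨fun h _ hx => h _ ((mem_fixedModulo hN).1 hx), fun h _ hx => h (Subgroup.subset_closure hx)⟩

theorem IsNormalAdmissible.fixedModulo (hφ : InnNormalized φ) (hN : IsNormalAdmissible φ N) :
    IsNormalAdmissible φ (fixedModulo φ N) := by
  refine closure (fun x hx g b => ?_) (fun x hx c b => ?_)
  · obtain ⟨b', hb'⟩ := hφ.exists_apply_eq g⁻¹ b
    have : (g * x * g⁻¹)⁻¹ * φ b (g * x * g⁻¹) = g * (x⁻¹ * φ b' x) * g⁻¹ := by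
      simp [hb', mul_assoc]
    rw [this]
    exact hN.conj_mem (hx b') g
  · have : (φ c x)⁻¹ * φ b (φ c x) = φ c (x⁻¹ * φ (c⁻¹ * b * c) x) := by simp
    rw [this]
    exact hN.admissible _ _ (hx _)

theorem isNormalAdmissible_hyperfixedModulo : IsNormalAdmissible φ (hyperfixedModulo φ L) :=
  IsNormalAdmissible.sInf fun _ h => h.1

theorem isFixedClosed_hyperfixedModulo : IsFixedClosed φ (hyperfixedModulo φ L) := fun x hx => by
  simp only [hyperfixedModulo, Subgroup.mem_sInf] at hx ⊢
  exact fun N hN => hN.2.1 x fun b => hx b N hN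

theorem le_hyperfixedModulo : L ≤ hyperfixedModulo φ L := le_sInf fun _ h => h.2.2

theorem hyperfixedModulo_le (h₁ : IsNormalAdmissible φ N) (h₂ : IsFixedClosed φ N) (h : L ≤ N) :
    hyperfixedModulo φ L ≤ N :=
  sInf_le ⟨h₁, h₂, h⟩

theorem hyperfixedModulo_le_hyperfixedModulo (h : K ≤ hyperfixedModulo φ L) :
    hyperfixedModulo φ K ≤ hyperfixedModulo φ L :=
  hyperfixedModulo_le isNormalAdmissible_hyperfixedModulo isFixedClosed_hyperfixedModulo h

theorem hyperfixedModulo_mono (h : K ≤ L) : hyperfixedModulo φ K ≤ hyperfixedModulo φ L :=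
  hyperfixedModulo_le_hyperfixedModulo (h.trans le_hyperfixedModulo)

theorem exists_maximal_isNormalAdmissible (hφ : InnNormalized φ) (hL : IsNormalAdmissible φ L)
    (P : Subgroup G → Prop) (hP : P L)
    (hchain : ∀ c : Set (Subgroup G), c.Nonempty → IsChain (· ≤ ·) c → (∀ N ∈ c, P N) →
      P (sSup c)) :
    ∃ N, IsNormalAdmissible φ N ∧ P N ∧ L ≤ N ∧
      (hyperfixedModulo φ L ≤ N ∨ ¬ P (fixedModulo φ N)) := by
  obtain ⟨N, hLN, hN⟩ := zorn_le_nonempty₀ {N | IsNormalAdmissible φ N ∧ P N}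
    (fun c hc hcc N hN => ⟨sSup c, ⟨.sSup_of_isChain ⟨N, hN⟩ hcc fun M hM => (hc hM).1,
      hchain c ⟨N, hN⟩ hcc fun M hM => (hc hM).2⟩, fun M hM => le_sSup hM⟩) L ⟨hL, hP⟩
  refine ⟨N, hN.prop.1, hN.prop.2, hLN, or_iff_not_imp_right.2 fun h => ?_⟩
  have hfix : fixedModulo φ N ≤ N :=
    hN.le_of_ge ⟨hN.prop.1.fixedModulo hφ, not_not.1 h⟩ hN.prop.1.admissible.le_fixedModulo
  exact hyperfixedModulo_le hN.prop.1 ((isFixedClosed_iff hN.prop.1.normal).2 hfix) hLN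

theorem exists_maximal_isNormalAdmissible_forall (hφ : InnNormalized φ)
    (hL : IsNormalAdmissible φ L) (p : G → Prop) (hp : ∀ x ∈ L, p x) :
    ∃ N, IsNormalAdmissible φ N ∧ (∀ x ∈ N, p x) ∧ L ≤ N ∧
      (hyperfixedModulo φ L ≤ N ∨ ∃ x, (∀ b, x⁻¹ * φ b x ∈ N) ∧ ¬ p x) := by
  obtain ⟨N, hN, hpN, hLN, hmax⟩ := exists_maximal_isNormalAdmissible hφ hL
    (fun N => ∀ x ∈ N, p x) hp fun c hne hc h x hx => by
      obtain ⟨N, hN, hx⟩ := (Subgroup.mem_sSup_of_directedOn hne hc.directedOn).1 hx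
      exact h N hN x hx
  refine ⟨N, hN, hpN, hLN, hmax.imp id fun h => ?_⟩
  push Not at h
  simpa only [mem_fixedModulo hN.normal] using h

theorem hyperfixedModulo_induction (hφ : InnNormalized φ) (hL : IsNormalAdmissible φ L)
    (p : G → Prop) (hp : ∀ x ∈ L, p x)
    (hstep : ∀ N, IsNormalAdmissible φ N → L ≤ N → (∀ x ∈ N, p x) →
      ∀ x, (∀ b, x⁻¹ * φ b x ∈ N) → p x) : ∀ x ∈ hyperfixedModulo φ L, p x := by
  obtain ⟨N, hN, hpN, hLN, hle | ⟨x, hx, hpx⟩⟩ :=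
    exists_maximal_isNormalAdmissible_forall hφ hL p hp
  · exact fun x hx => hpN x (hle hx)
  · exact absurd (hstep N hN hLN hpN x hx) hpx

theorem exists_fixed_modulo_of_le_hyperfixedModulo (hφ : InnNormalized φ)
    (hL : IsNormalAdmissible φ L) (hH : IsAdmissible φ H) (hle : H ≤ hyperfixedModulo φ L)
    (hne : ¬ H ≤ L) : ∃ x ∈ H, x ∉ L ∧ ∀ b, x⁻¹ * φ b x ∈ L := by
  obtain ⟨N, -, hN, -, hle' | ⟨x, hx, hpx⟩⟩ :=
    exists_maximal_isNormalAdmissible_forall hφ hL (fun x => x ∈ H → x ∈ L) fun x hx _ => hx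
  · exact absurd (fun x hx => hN x (hle' (hle hx)) hx) hne
  · push Not at hpx
    exact ⟨x, hpx.1, hpx.2, fun b => hN _ (hx b) (hH.inv_mul_apply_mem hpx.1 b)⟩

theorem exists_mem_superset_of_finite_of_subset_sSup {c : Set (Subgroup G)} (hne : c.Nonempty)
    (hc : IsChain (· ≤ ·) c) {F : Set G} (hF : F.Finite) (h : F ⊆ (sSup c : Subgroup G)) :
    ∃ N ∈ c, F ⊆ N := by
  have hunion : F ⊆ ⋃₀ ((fun N : Subgroup G => (N : Set G)) '' c) := fun x hx => by
    simpa using (Subgroup.mem_sSup_of_directedOn hne hc.directedOn).1 (h hx)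
  have hdir : DirectedOn (· ⊆ ·) ((fun N : Subgroup G => (N : Set G)) '' c) :=
    directedOn_image.2 hc.directedOn
  obtain ⟨_, ⟨N, hN, rfl⟩, hFN⟩ :=
    hdir.exists_mem_subset_of_finite_of_subset_sUnion (hne.image _) hF hunion
  exact ⟨N, hN, hFN⟩

theorem exists_isNormalAdmissible_of_finite (hφ : InnNormalized φ) (hL : IsNormalAdmissible φ L)
    {F : Set G} (hF : F.Finite) (hFL : F ⊆ hyperfixedModulo φ L) (hne : ¬ F ⊆ L) :
    ∃ N, IsNormalAdmissible φ N ∧ L ≤ N ∧ ¬ F ⊆ N ∧ ∀ x ∈ F, ∀ b, x⁻¹ * φ b x ∈ N := by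
  obtain ⟨N, hN, hFN, hLN, hmax⟩ :=
    exists_maximal_isNormalAdmissible hφ hL (fun N => ¬ F ⊆ N) hne fun c hne hc h hFc => by
      obtain ⟨N, hN, hFN⟩ := exists_mem_superset_of_finite_of_subset_sSup hne hc hF hFc
      exact h N hN hFN
  have hfix : F ⊆ fixedModulo φ N :=
    not_not.1 (hmax.resolve_left fun h => hFN (hFL.trans h))
  exact ⟨N, hN, hLN, hFN, fun x hx => (mem_fixedModulo hN.normal).1 (hfix hx)⟩

end Operators

section SemiEquivariant

variable {G G' B C : Type*} [Group G] [Group G'] [Group B] [Group C]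

/-- The homomorphism `f` carries the set of operators on `G` onto the set of operators on `G'`.
Admissibility and fixed points depend only on this set, so no homomorphism between the operator
groups is required. -/
structure IsSemiEquivariant (φ : B →* MulAut G) (ψ : C →* MulAut G') (f : G →* G') : Prop where
  exists_right : ∀ b, ∃ c, ∀ x, f (φ b x) = ψ c (f x)
  exists_left : ∀ c, ∃ b, ∀ x, f (φ b x) = ψ c (f x)

/-- The subgroup `K` lies in the hyperfixed subgroup modulo a finite normal admissible subgroup. -/
def FiniteByHyperfixed (φ : B →* MulAut G) (K : Subgroup G) : Prop :=
  ∃ L, IsNormalAdmissible φ L ∧ Finite L ∧ K ≤ hyperfixedModulo φ L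

theorem IsSemiEquivariant.of_equivariant {φ : B →* MulAut G} {ψ : B →* MulAut G'} {f : G →* G'}
    (h : ∀ b x, f (φ b x) = ψ b (f x)) : IsSemiEquivariant φ ψ f :=
  ⟨fun b => ⟨b, h b⟩, fun b => ⟨b, h b⟩⟩

theorem InnNormalized.isSemiEquivariant_conj {φ : B →* MulAut G} (hφ : InnNormalized φ) (g : G) :
    IsSemiEquivariant φ φ (MulAut.conj g).toMonoidHom := by
  constructor
  · intro b
    obtain ⟨c, hc⟩ := hφ.exists_apply_eq g b
    exact ⟨c, fun x => by simp [hc, mul_assoc]⟩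
  · intro c
    obtain ⟨b, hb⟩ := hφ.exists_apply_eq g⁻¹ c
    exact ⟨b, fun x => by simp [hb, mul_assoc]⟩

variable {φ : B →* MulAut G} {ψ : C →* MulAut G'} {f : G →* G'}
  {K L N : Subgroup G} {L' N' : Subgroup G'}

namespace IsSemiEquivariant

theorem isNormalAdmissible_comap (hf : IsSemiEquivariant φ ψ f) (h : IsNormalAdmissible ψ N') :
    IsNormalAdmissible φ (N'.comap f) where
  normal := h.normal.comap f
  admissible b x hx := by
    obtain ⟨c, hc⟩ := hf.exists_right b
    rw [Subgroup.mem_comap] at hx ⊢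
    rw [hc]
    exact h.admissible c _ hx

theorem isFixedClosed_comap (hf : IsSemiEquivariant φ ψ f) (h : IsFixedClosed ψ N') :
    IsFixedClosed φ (N'.comap f) := fun x hx => h _ fun c => by
  obtain ⟨b, hb⟩ := hf.exists_left c
  simpa [Subgroup.mem_comap, hb] using hx b

theorem hyperfixedModulo_le_comap (hf : IsSemiEquivariant φ ψ f)
    (h : L ≤ (hyperfixedModulo ψ L').comap f) :
    hyperfixedModulo φ L ≤ (hyperfixedModulo ψ L').comap f :=
  hyperfixedModulo_le (hf.isNormalAdmissible_comap isNormalAdmissible_hyperfixedModulo)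
    (hf.isFixedClosed_comap isFixedClosed_hyperfixedModulo) h

theorem isNormalAdmissible_map (hf : IsSemiEquivariant φ ψ f) (hs : Function.Surjective f)
    (h : IsNormalAdmissible φ N) : IsNormalAdmissible ψ (N.map f) where
  normal := h.normal.map f hs
  admissible c y hy := by
    obtain ⟨b, hb⟩ := hf.exists_left c
    obtain ⟨x, hx, rfl⟩ := hy
    exact ⟨φ b x, h.admissible b x hx, hb x⟩

theorem isFixedClosed_map (hf : IsSemiEquivariant φ ψ f) (hs : Function.Surjective f)
    (hN : IsFixedClosed φ N) (hker : f.ker ≤ N) : IsFixedClosed ψ (N.map f) := by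
  intro y hy
  obtain ⟨x, rfl⟩ := hs y
  refine ⟨x, hN x fun b => ?_, rfl⟩
  obtain ⟨c, hc⟩ := hf.exists_right b
  have := hy c
  rw [← hc, ← map_inv, ← map_mul] at this
  rwa [← Subgroup.mem_comap, Subgroup.comap_map_eq_self hker] at this

theorem comap_hyperfixedModulo (hf : IsSemiEquivariant φ ψ f) (hs : Function.Surjective f) :
    (hyperfixedModulo ψ L').comap f = hyperfixedModulo φ (L'.comap f) := by
  refine le_antisymm ?_ (hf.hyperfixedModulo_le_comap (Subgroup.comap_mono le_hyperfixedModulo))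
  have hker : f.ker ≤ hyperfixedModulo φ (L'.comap f) :=
    (Subgroup.comap_mono bot_le).trans le_hyperfixedModulo
  rw [← Subgroup.comap_map_eq_self hker]
  refine Subgroup.comap_mono (hyperfixedModulo_le
    (hf.isNormalAdmissible_map hs isNormalAdmissible_hyperfixedModulo)
    (hf.isFixedClosed_map hs isFixedClosed_hyperfixedModulo hker) ?_)
  rw [← Subgroup.map_comap_eq_self_of_surjective hs L']
  exact Subgroup.map_mono (by
    rw [Subgroup.map_comap_eq_self_of_surjective hs]
    exact le_hyperfixedModulo)

theorem innNormalized (hf : IsSemiEquivariant φ ψ f) (hs : Function.Surjective f)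
    (hφ : InnNormalized φ) : InnNormalized ψ := by
  intro g' c
  obtain ⟨g, rfl⟩ := hs g'
  obtain ⟨b, hb⟩ := hf.exists_left c
  obtain ⟨b', hb'⟩ := hφ.exists_apply_eq g b
  obtain ⟨c', hc'⟩ := hf.exists_right b'
  refine ⟨c', MulEquiv.ext fun y => ?_⟩
  obtain ⟨x, rfl⟩ := hs y
  simp [← hc', hb', hb]

end IsSemiEquivariant

theorem finite_comap_of_finite_ker (f : G →* G') (H : Subgroup G') [Finite H] [Finite f.ker] :
    Finite (H.comap f) := by
  have : Finite (f.subgroupComap H).ker :=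
    Finite.of_injective (fun x => (⟨x, congrArg Subtype.val x.2⟩ : f.ker)) fun x y h =>
      Subtype.ext (Subtype.ext (Subtype.mk.inj h))
  exact (MonoidHom.finite_iff_finite_ker_range (f.subgroupComap H)).2 ⟨this, inferInstance⟩

namespace FiniteByHyperfixed

theorem mono (hK : FiniteByHyperfixed φ K) (h : N ≤ K) : FiniteByHyperfixed φ N := by
  obtain ⟨L, hL, hfin, hKL⟩ := hK
  exact ⟨L, hL, hfin, h.trans hKL⟩

theorem of_le_hyperfixedModulo (hN : FiniteByHyperfixed φ N) (h : K ≤ hyperfixedModulo φ N) :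
    FiniteByHyperfixed φ K := by
  obtain ⟨L, hL, hfin, hNL⟩ := hN
  exact ⟨L, hL, hfin, h.trans (hyperfixedModulo_le_hyperfixedModulo hNL)⟩

theorem hyperfixedModulo_bot : FiniteByHyperfixed φ (hyperfixedModulo φ ⊥) :=
  ⟨⊥, .bot, inferInstance, le_rfl⟩

theorem comap {K' : Subgroup G'} (hK' : FiniteByHyperfixed ψ K') (hf : IsSemiEquivariant φ ψ f)
    (hs : Function.Surjective f) [Finite f.ker] : FiniteByHyperfixed φ (K'.comap f) := by
  obtain ⟨L', hL', hfin, hle⟩ := hK'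
  refine ⟨L'.comap f, hf.isNormalAdmissible_comap hL', finite_comap_of_finite_ker f L', ?_⟩
  rw [← hf.comap_hyperfixedModulo hs]
  exact Subgroup.comap_mono hle

end FiniteByHyperfixed

end SemiEquivariant

section CentralizerModulo

variable {G B : Type*} [Group G] [Group B] {φ : B →* MulAut G} {H T : Subgroup G}

/-- The operators that fix every element of the set `s` modulo the admissible subgroup `T`. -/
def centralizerModulo (φ : B →* MulAut G) (s : Set G) (T : Subgroup G) (hT : IsAdmissible φ T) :
    Subgroup B where
  carrier := {b | ∀ x ∈ s, x⁻¹ * φ b x ∈ T}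
  one_mem' := by simp
  mul_mem' {b c} hb hc x hx := by
    have : x⁻¹ * φ (b * c) x = (x⁻¹ * φ b x) * φ b (x⁻¹ * φ c x) := by simp
    rw [this]
    exact T.mul_mem (hb x hx) (hT b _ (hc x hx))
  inv_mem' {b} hb x hx := by
    have : x⁻¹ * φ b⁻¹ x = (φ b⁻¹ (x⁻¹ * φ b x))⁻¹ := by simp
    rw [this]
    exact T.inv_mem (hT _ _ (hb x hx))

theorem mem_centralizerModulo {s : Set G} {hT : IsAdmissible φ T} {b : B} :
    b ∈ centralizerModulo φ s T hT ↔ ∀ x ∈ s, x⁻¹ * φ b x ∈ T :=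
  Iff.rfl

theorem mem_centralizerModulo_bot {s : Set G} {hT : IsAdmissible φ (⊥ : Subgroup G)} {b : B} :
    b ∈ centralizerModulo φ s ⊥ hT ↔ ∀ x ∈ s, φ b x = x := by
  simp_rw [mem_centralizerModulo, Subgroup.mem_bot, inv_mul_eq_one, eq_comm]

theorem normal_centralizerModulo (hT : IsAdmissible φ T) (hH : IsAdmissible φ H) :
    (centralizerModulo φ H T hT).Normal := by
  refine ⟨fun r hr b x hx => ?_⟩
  have : x⁻¹ * φ (b * r * b⁻¹) x = φ b ((φ b⁻¹ x)⁻¹ * φ r (φ b⁻¹ x)) := by simp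
  rw [this]
  exact hT b _ (hr _ (hH b⁻¹ x hx))

theorem ker_le_centralizerModulo (s : Set G) (hT : IsAdmissible φ T) :
    φ.ker ≤ centralizerModulo φ s T hT := fun b hb x _ => by
  simp [MonoidHom.mem_ker.1 hb]

end CentralizerModulo

section Residual

variable {G B : Type*} [Group G] [Group B]

/-- A minimal element among the finite normal admissible subgroups with hyperfixed quotient. By
`IsFiniteResidual.le` it is the least normal admissible subgroup with hyperfixed quotient. -/
def IsFiniteResidual (φ : B →* MulAut G) (R : Subgroup G) : Prop :=
  Minimal (fun R => IsNormalAdmissible φ R ∧ Finite R ∧ hyperfixedModulo φ R = ⊤) R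

variable {φ : B →* MulAut G} {L M N R : Subgroup G}

theorem FiniteByHyperfixed.exists_isFiniteResidual (h : FiniteByHyperfixed φ ⊤) :
    ∃ R, IsFiniteResidual φ R := by
  obtain ⟨L, hL, hfin, htop⟩ := h
  have hfin' : {R | (IsNormalAdmissible φ R ∧ Finite R ∧ hyperfixedModulo φ R = ⊤) ∧
      R ≤ L}.Finite := by
    refine Set.Finite.subset ?_ fun R hR => hR.2
    exact Set.Finite.of_finite_image ((Set.toFinite (L : Set G)).finite_subsets.subset
      (by rintro _ ⟨R, hR, rfl⟩; exact hR)) SetLike.coe_injective.injOn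
  obtain ⟨R, hR⟩ := hfin'.exists_minimal ⟨L, ⟨hL, hfin, top_le_iff.1 htop⟩, le_rfl⟩
  exact ⟨R, hR.prop.1, fun S hS hSR => hR.le_of_le ⟨hS, hSR.trans hR.prop.2⟩ hSR⟩

namespace IsFiniteResidual

theorem isNormalAdmissible (hR : IsFiniteResidual φ R) : IsNormalAdmissible φ R :=
  hR.prop.1

theorem finite (hR : IsFiniteResidual φ R) : Finite R :=
  hR.prop.2.1

theorem hyperfixedModulo_eq_top (hR : IsFiniteResidual φ R) : hyperfixedModulo φ R = ⊤ :=
  hR.prop.2.2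

theorem le_of_inv_mul_apply_mem (hR : IsFiniteResidual φ R) (hN : IsNormalAdmissible φ N)
    (h : ∀ r ∈ R, ∀ b, r⁻¹ * φ b r ∈ N) : R ≤ N := by
  have := hR.finite
  have hle : R ≤ hyperfixedModulo φ (R ⊓ N) := fun r hr => isFixedClosed_hyperfixedModulo r fun b =>
    le_hyperfixedModulo ⟨hR.isNormalAdmissible.admissible.inv_mul_apply_mem hr b, h r hr b⟩
  have htop : hyperfixedModulo φ (R ⊓ N) = ⊤ := top_le_iff.1
    (hR.hyperfixedModulo_eq_top.ge.trans (hyperfixedModulo_le_hyperfixedModulo hle))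
  have hfin : Finite (R ⊓ N : Subgroup G) :=
    Finite.of_injective _ (Subgroup.inclusion_injective inf_le_left)
  exact (hR.le_of_le ⟨hR.isNormalAdmissible.inf hN, hfin, htop⟩ inf_le_left).trans inf_le_right

theorem le (hφ : InnNormalized φ) (hR : IsFiniteResidual φ R) (hL : IsNormalAdmissible φ L)
    (h : hyperfixedModulo φ L = ⊤) : R ≤ L := by
  by_contra hne
  have := hR.finite
  obtain ⟨N, hN, -, hRN, hfix⟩ := exists_isNormalAdmissible_of_finite hφ hL (F := R)
    (Set.toFinite _) (by simp [h]) hne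
  exact hRN (hR.le_of_inv_mul_apply_mem hN hfix)

theorem apply_mem (hφ : InnNormalized φ) (hR : IsFiniteResidual φ R) {f : G →* G}
    (hf : IsSemiEquivariant φ φ f) (hs : Function.Surjective f) {r : G} (hr : r ∈ R) : f r ∈ R := by
  have : R ≤ R.comap f := hR.le hφ (hf.isNormalAdmissible_comap hR.isNormalAdmissible) (by
    rw [← hf.comap_hyperfixedModulo hs, hR.hyperfixedModulo_eq_top, Subgroup.comap_top])
  exact this hr

end IsFiniteResidual

theorem innNormalized_conj : InnNormalized (MulAut.conj : G →* MulAut G) := fun g b =>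
  ⟨g * b * g⁻¹, by simp⟩

theorem isNormalAdmissible_conj_iff :
    IsNormalAdmissible (MulAut.conj : G →* MulAut G) N ↔ N.Normal :=
  ⟨fun h => h.normal, fun h => ⟨h, fun b x hx => by simpa using h.conj_mem x hx b⟩⟩

theorem exists_central_modulo {K N : Subgroup B} (hK : hyperfixedModulo MulAut.conj K = ⊤)
    (hN : N.Normal) (hKN : K ≤ N) (hne : N ≠ ⊤) :
    ∃ a, a ∉ N ∧ ∀ b, a⁻¹ * (b * a * b⁻¹) ∈ N := by
  by_contra! h
  refine hne (top_le_iff.1 (hK.ge.trans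
    (hyperfixedModulo_le (isNormalAdmissible_conj_iff.2 hN) ?_ hKN)))
  intro a ha
  by_contra haN
  obtain ⟨b, hb⟩ := h a haN
  exact hb (ha b)

theorem InnNormalized.inv_commutator_mul_commutator_conj_mem (hφ : InnNormalized φ)
    (hM : IsNormalAdmissible φ M) {x : G} {r b : B}
    (hfix : ∀ c, (x⁻¹ * φ r x)⁻¹ * φ c (x⁻¹ * φ r x) ∈ M)
    (hb : (x⁻¹ * φ b⁻¹ x)⁻¹ * φ r (x⁻¹ * φ b⁻¹ x) ∈ M) :
    (x⁻¹ * φ r x)⁻¹ * (x⁻¹ * φ (b * r * b⁻¹) x) ∈ M := by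
  obtain ⟨c, hc⟩ := hφ.exists_apply_eq x⁻¹ b
  have hsplit : x⁻¹ * φ (b * r * b⁻¹) x =
      φ c (x⁻¹ * φ r x) * φ b ((x⁻¹ * φ b⁻¹ x)⁻¹ * φ r (x⁻¹ * φ b⁻¹ x)) := by
    simp [hc, mul_assoc]
  rw [hsplit, ← mul_assoc]
  exact M.mul_mem (hfix c) (hM.admissible b _ hb)

theorem IsFiniteResidual.le_centralizerModulo_singleton (hφ : InnNormalized φ) {R : Subgroup B}
    (hR : IsFiniteResidual MulAut.conj R) (hM : IsNormalAdmissible φ M) {x : G}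
    (hfix : ∀ r ∈ R, ∀ c, (x⁻¹ * φ r x)⁻¹ * φ c (x⁻¹ * φ r x) ∈ M)
    (hb : ∀ r ∈ R, ∀ b, (x⁻¹ * φ b x)⁻¹ * φ r (x⁻¹ * φ b x) ∈ M) :
    R ≤ centralizerModulo φ {x} M hM.admissible := by
  have hkey : ∀ r ∈ R, ∀ b, (x⁻¹ * φ r x)⁻¹ * (x⁻¹ * φ (b * r * b⁻¹) x) ∈ M := fun r hr b =>
    hφ.inv_commutator_mul_commutator_conj_mem hM (hfix r hr) (hb r hr b⁻¹)
  have hnormal : (R ⊓ centralizerModulo φ {x} M hM.admissible).Normal := by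
    refine ⟨fun r hr b => ⟨hR.isNormalAdmissible.conj_mem hr.1 b, ?_⟩⟩
    rintro _ rfl
    simpa using M.mul_mem (hr.2 _ rfl) (hkey r hr.1 b)
  refine (hR.le_of_inv_mul_apply_mem (isNormalAdmissible_conj_iff.2 hnormal)
    fun r hr b => ⟨hR.isNormalAdmissible.admissible.inv_mul_apply_mem hr b, ?_⟩).trans inf_le_right
  rintro _ rfl
  simpa using hM.admissible r⁻¹ _ (hkey r hr b)

theorem IsFiniteResidual.inv_mul_apply_mem (hφ : InnNormalized φ) {R : Subgroup B}
    (hR : IsFiniteResidual MulAut.conj R) (hL : IsNormalAdmissible φ L) :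
    ∀ x ∈ hyperfixedModulo φ L, ∀ r ∈ R, x⁻¹ * φ r x ∈ L := by
  suffices ∀ x ∈ hyperfixedModulo φ L, x ∈ hyperfixedModulo φ L ∧ ∀ r ∈ R, x⁻¹ * φ r x ∈ L from
    fun x hx => (this x hx).2
  refine hyperfixedModulo_induction hφ hL _ (fun x hx => ⟨le_hyperfixedModulo hx, fun r _ =>
    hL.admissible.inv_mul_apply_mem hx r⟩) fun N _ _ hind x hx =>
    ⟨isFixedClosed_hyperfixedModulo x fun b => (hind _ (hx b)).1, ?_⟩
  have := hR.finite
  by_contra hcon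
  obtain ⟨M, hM, hLM, hnot, hfix⟩ := exists_isNormalAdmissible_of_finite hφ hL
    (F := (fun r => x⁻¹ * φ r x) '' R) ((Set.toFinite _).image _)
    (by rintro _ ⟨r, -, rfl⟩; exact (hind _ (hx r)).1)
    (fun h => hcon fun r hr => h ⟨r, hr, rfl⟩)
  have hRx : R ≤ centralizerModulo φ {x} M hM.admissible :=
    hR.le_centralizerModulo_singleton hφ hM (fun r hr => hfix _ ⟨r, hr, rfl⟩)
      fun r hr b => hLM ((hind _ (hx b)).2 r hr)
  apply hnot
  rintro _ ⟨r, hr, rfl⟩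
  exact hRx hr x rfl

end Residual

section Displacement

variable {X B : Type*} [CommGroup X] [Group B]

/-- The endomorphism `x ↦ x⁻¹ b(x)` of a commutative group. -/
def displacement (φ : B →* MulAut X) (b : B) : X →* X where
  toFun x := x⁻¹ * φ b x
  map_one' := by simp
  map_mul' x y := by
    rw [map_mul, mul_inv]
    exact mul_mul_mul_comm _ _ _ _

variable {φ : B →* MulAut X} {T Z : Subgroup X} {N : Subgroup B} {a : B} {x : X}

theorem displacement_apply (φ : B →* MulAut X) (b : B) (x : X) :
    displacement φ b x = x⁻¹ * φ b x :=
  rfl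

theorem inv_apply_displacement_mul_displacement_apply_mem (hT : IsAdmissible φ T)
    (ha : ∀ b, a⁻¹ * (b * a * b⁻¹) ∈ N) (hN : ∀ c ∈ N, x⁻¹ * φ c x ∈ T) (b : B) :
    (φ b (displacement φ a x))⁻¹ * displacement φ a (φ b x) ∈ T := by
  have hcomm : (φ b (displacement φ a x))⁻¹ * displacement φ a (φ b x) =
      φ (b * a) (x⁻¹ * φ (a⁻¹ * (b⁻¹ * a * b⁻¹⁻¹)) x) := by
    simp [displacement_apply]
  rw [hcomm]
  exact hT _ _ (hN _ (ha b⁻¹))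

theorem displacement_apply_comm (ha : ∀ b, a⁻¹ * (b * a * b⁻¹) ∈ N) (hN : ∀ c ∈ N, φ c x = x)
    (b : B) : displacement φ a (φ b x) = φ b (displacement φ a x) := by
  have hN' : ∀ c ∈ N, x⁻¹ * φ c x ∈ (⊥ : Subgroup X) := fun c hc => by simp [hN c hc]
  exact (inv_mul_eq_one.1 (inv_apply_displacement_mul_displacement_apply_mem
    IsNormalAdmissible.bot.admissible ha hN' b)).symm

theorem exists_commuting_displacement (hker : hyperfixedModulo MulAut.conj φ.ker = ⊤)
    (hT : IsAdmissible φ T) (hne : ∃ t ∈ T, ∃ b, φ b t ≠ t) :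
    ∃ a, (∃ t ∈ T, φ a t ≠ t) ∧ ∀ t ∈ T, ∀ b,
      (displacement φ a t)⁻¹ * φ b (displacement φ a t) = displacement φ a (t⁻¹ * φ b t) := by
  have hbot : IsAdmissible φ (⊥ : Subgroup X) := IsNormalAdmissible.bot.admissible
  have htop : centralizerModulo φ T ⊥ hbot ≠ ⊤ := by
    obtain ⟨t, ht, b, hb⟩ := hne
    exact fun h => hb (mem_centralizerModulo_bot.1 (h ▸ Subgroup.mem_top b) t ht)
  obtain ⟨a, ha, hcomm⟩ := exists_central_modulo hker (normal_centralizerModulo hbot hT)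
    (ker_le_centralizerModulo _ hbot) htop
  rw [mem_centralizerModulo_bot] at ha
  push Not at ha
  refine ⟨a, ha, fun t ht b => ?_⟩
  rw [map_mul, map_inv,
    displacement_apply_comm hcomm (fun c hc => mem_centralizerModulo_bot.1 hc t ht)]

theorem le_of_inf_ker_le_of_map_le {G G' : Type*} [Group G] [Group G'] {f : G →* G'}
    {H K : Subgroup G} (hKH : K ≤ H) (hker : H ⊓ f.ker ≤ K) (hmap : H.map f ≤ K.map f) :
    H ≤ K := by
  intro x hx
  obtain ⟨y, hy, hyx⟩ := hmap ⟨x, hx, rfl⟩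
  have hyx' : y⁻¹ * x ∈ K := hker ⟨H.mul_mem (H.inv_mem (hKH hy)) hx, by simp [hyx]⟩
  simpa using K.mul_mem hy hyx'

theorem le_of_forall_fixed_eq_one (hker : hyperfixedModulo MulAut.conj φ.ker = ⊤) [Finite Z]
    (hZT : Z ≤ T) (hTZ : ∀ t ∈ T, ∀ b, t⁻¹ * φ b t ∈ Z)
    (hfix : ∀ t ∈ T, (∀ b, φ b t = t) → t = 1) : T ≤ Z := by
  induction hn : Nat.card Z using Nat.strong_induction_on generalizing T Z with
  | _ n ih =>
  have hT : IsAdmissible φ T := isAdmissible_of_inv_mul_apply_mem fun t ht b => hZT (hTZ t ht b)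
  by_cases hne : ∃ t ∈ T, ∃ b, φ b t ≠ t
  swap
  · push Not at hne
    exact fun t ht => hfix t ht (hne t ht) ▸ Z.one_mem
  obtain ⟨a, ⟨s, hs, hsa⟩, hδ⟩ := exists_commuting_displacement hker hT hne
  set δ := displacement φ a
  have hδZ : ∀ t ∈ T, δ t ∈ Z := fun t ht => hTZ t ht a
  have hZker : ¬ Z ≤ δ.ker := fun hle => hsa <| (inv_mul_eq_one.1 <|
    hfix _ (hZT (hδZ s hs)) fun b => (inv_mul_eq_one.1 <|
      (hδ s hs b).trans (hle (hTZ s hs b))).symm).symm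
  have hker' : T ⊓ δ.ker ≤ Z ⊓ δ.ker := by
    have hlt : Z ⊓ δ.ker < Z := inf_lt_left.2 hZker
    have : Finite (Z ⊓ δ.ker : Subgroup X) :=
      Finite.of_injective _ (Subgroup.inclusion_injective hlt.le)
    have hcard : Nat.card (Z ⊓ δ.ker : Subgroup X) < n :=
      hn ▸ lt_of_not_ge fun h => hlt.ne (Subgroup.eq_of_le_of_card_ge hlt.le h)
    refine ih _ hcard (inf_le_inf_right _ hZT) (fun t ht b => ⟨hTZ t ht.1 b, ?_⟩)
      (fun t ht => hfix t ht.1) rfl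
    change δ _ = 1
    rw [← hδ t ht.1 b, MonoidHom.mem_ker.1 ht.2, inv_one, map_one, mul_one]
  have hmap : T.map δ ≤ Z.map δ := by
    have hle : Z.map δ ≤ Z := Subgroup.map_le_iff_le_comap.2 fun z hz => hδZ z (hZT hz)
    have : Finite (Z.map δ) := Finite.of_injective _ (Subgroup.inclusion_injective hle)
    rcases lt_or_ge (Nat.card (Z.map δ)) n with hlt | hge
    · refine ih _ hlt (Subgroup.map_mono hZT) ?_ ?_ rfl
      · rintro _ ⟨t, ht, rfl⟩ b
        exact ⟨_, hTZ t ht b, (hδ t ht b).symm⟩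
      · rintro _ ⟨t, ht, rfl⟩
        exact hfix _ (hZT (hδZ t ht))
    · rw [Subgroup.eq_of_le_of_card_ge hle (hn ▸ hge)]
      exact Subgroup.map_le_iff_le_comap.2 hδZ
  exact le_of_inf_ker_le_of_map_le hZT (hker'.trans inf_le_left) hmap

end Displacement

section InducedOperators

variable {G B : Type*} [Group G] [Group B]

/-- The action of the operators on an admissible subgroup. -/
def restrictOperators (φ : B →* MulAut G) (H : Subgroup G) (hH : IsAdmissible φ H) :
    B →* MulAut H where
  toFun b :=
    { toFun := fun x => ⟨φ b x, hH b x x.2⟩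
      invFun := fun x => ⟨φ b⁻¹ x, hH b⁻¹ x x.2⟩
      left_inv := fun x => by simp
      right_inv := fun x => by simp
      map_mul' := fun x y => by simp }
  map_one' := by ext x; simp
  map_mul' a b := by ext x; simp

/-- The action of the operators on the quotient by a normal admissible subgroup. -/
def quotientOperators (φ : B →* MulAut G) (N : Subgroup G) [N.Normal] (hN : IsAdmissible φ N) :
    B →* MulAut (G ⧸ N) where
  toFun b := QuotientGroup.congr N N (φ b) (by
    ext x
    constructor
    · rintro ⟨y, hy, rfl⟩
      exact hN b y hy
    · exact fun hx => ⟨φ b⁻¹ x, hN _ x hx, by simp⟩)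
  map_one' := by
    ext x
    induction x using QuotientGroup.induction_on with
    | H g => simp
  map_mul' a b := by
    ext x
    induction x using QuotientGroup.induction_on with
    | H g => simp

theorem isSemiEquivariant_mk' (φ : B →* MulAut G) (N : Subgroup G) [N.Normal]
    (hN : IsAdmissible φ N) :
    IsSemiEquivariant φ (quotientOperators φ N hN) (QuotientGroup.mk' N) :=
  .of_equivariant fun _ _ => rfl

theorem isSemiEquivariant_subtype (φ : B →* MulAut G) (H : Subgroup G) (hH : IsAdmissible φ H) :
    IsSemiEquivariant (restrictOperators φ H hH) φ H.subtype :=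
  .of_equivariant fun _ _ => rfl

end InducedOperators

section FixedPointFree

open scoped commutatorElement

variable {G B : Type*} [Group G] [Group B] {φ : B →* MulAut G} {K L : Subgroup G} {R : Subgroup B}

theorem finiteIndex_fixedModulo_bot [Finite B] [Finite L] (h : ∀ x b, x⁻¹ * φ b x ∈ L) :
    (fixedModulo φ ⊥).FiniteIndex := by
  let f : G → B → L := fun x b => ⟨x⁻¹⁻¹ * φ b x⁻¹, h x⁻¹ b⟩
  have hf : ∀ x y, f x = f y → x⁻¹ * y ∈ fixedModulo φ ⊥ := fun x y hxy => by
    rw [mem_fixedModulo_bot]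
    intro b
    have hb : x * (φ b x)⁻¹ = y * (φ b y)⁻¹ := by
      simpa [f] using congrArg Subtype.val (congrFun hxy b)
    rw [map_mul, map_inv, eq_inv_mul_iff_mul_eq, ← mul_assoc, hb, inv_mul_cancel_right]
  have : Finite (G ⧸ fixedModulo φ ⊥) := by
    refine Finite.of_injective (fun q => f q.out) fun p q hpq => ?_
    rw [← p.out_eq', ← q.out_eq', QuotientGroup.eq]
    exact hf _ _ hpq
  exact Subgroup.finiteIndex_of_finite_quotient

theorem finiteIndex_centralizer_of_finite [L.Normal] [Finite L] :
    (Subgroup.centralizer (L : Set G)).FiniteIndex := by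
  have hker : (MulAut.conjNormal : G →* MulAut L).ker ≤ Subgroup.centralizer (L : Set G) :=
    fun g hg l hl => by
      have := congrArg Subtype.val (DFunLike.congr_fun hg ⟨l, hl⟩)
      rw [MulAut.conjNormal_apply] at this
      exact (mul_inv_eq_iff_eq_mul.1 this).symm
  exact Subgroup.finiteIndex_of_le hker

theorem commutatorElement_mul_mul_eq {v w l m : G} (hlw : Commute l w) (hlm : Commute l m)
    (hvm : Commute v m) : ⁅v * l, w * m⁆ = ⁅v, w⁆ := by
  calc ⁅v * l, w * m⁆ = v * (l * (w * m)) * l⁻¹ * v⁻¹ * m⁻¹ * w⁻¹ := by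
        rw [commutatorElement_def]; group
    _ = v * w * (m * v⁻¹) * m⁻¹ * w⁻¹ := by rw [(hlw.mul_right hlm).eq]; group
    _ = ⁅v, w⁆ := by rw [hvm.symm.inv_right.eq, commutatorElement_def]; group

theorem isAdmissible_centralizer (hL : IsAdmissible φ L) :
    IsAdmissible φ (Subgroup.centralizer (L : Set G)) := fun b x hx l hl => by
  simpa using congrArg (φ b) (hx _ (hL b⁻¹ l hl))

theorem isAdmissible_fixedModulo_comp_subtype [hR : R.Normal] :
    IsAdmissible φ (fixedModulo (φ.comp R.subtype) ⊥) := fun b x hx => by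
  rw [mem_fixedModulo_bot] at hx ⊢
  intro r
  simpa using congrArg (φ b) (hx ⟨b⁻¹ * r * b⁻¹⁻¹, hR.conj_mem r r.2 b⁻¹⟩)

theorem inf_fixedModulo_le_of_forall_fixed_eq_one (hφ : InnNormalized φ)
    (hR : hyperfixedModulo MulAut.conj R = ⊤) (hL : IsNormalAdmissible φ L) [Finite L]
    (hK : IsAdmissible φ K) (hKR : ∀ x ∈ K, ∀ r ∈ R, φ r x = x)
    (hKL : K ≤ Subgroup.centralizer (L : Set G)) (hfix : ∀ x, (∀ b, φ b x = x) → x = 1) :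
    K ⊓ fixedModulo φ L ≤ L := by
  set V := K ⊓ fixedModulo φ L
  have hVL : ∀ v ∈ V, ∀ b, v⁻¹ * φ b v ∈ L := fun v hv => (mem_fixedModulo hL.normal).1 hv.2
  have hV : IsAdmissible φ V := fun b v hv =>
    ⟨hK b v hv.1, (hL.fixedModulo hφ).admissible b v hv.2⟩
  -- `L` centralizes `V`, so the operators fix the commutators of elements of `V`.
  have hcomm : ∀ v ∈ V, ∀ w ∈ V, v * w = w * v := fun v hv w hw => by
    refine commutatorElement_eq_one_iff_mul_comm.1 (hfix _ fun b => ?_)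
    have := commutatorElement_mul_mul_eq (v := v) (hKL hw.1 _ (hVL v hv b))
      (hKL (hK.inv_mul_apply_mem hv.1 b) _ (hVL w hw b)).symm (hKL hv.1 _ (hVL w hw b)).symm
    simpa only [mul_inv_cancel_left, map_commutatorElement] using this
  let _ : CommGroup V :=
    { (inferInstance : Group V) with mul_comm := fun v w => Subtype.ext (hcomm v v.2 w w.2) }
  have hker : hyperfixedModulo MulAut.conj (restrictOperators φ V hV).ker = ⊤ := by
    refine top_le_iff.1 (hR.ge.trans (hyperfixedModulo_mono fun r hr => ?_))
    ext v
    exact hKR v v.2.1 r hr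
  have : Finite (L.subgroupOf V) :=
    Finite.of_injective (fun z => (⟨z.1.1, z.2⟩ : L)) fun y z hyz =>
      Subtype.ext (Subtype.ext (Subtype.mk.inj hyz))
  have htop : ⊤ ≤ L.subgroupOf V := le_of_forall_fixed_eq_one hker le_top (fun t _ b => hVL t t.2 b)
    fun t _ ht => Subtype.ext (hfix t fun b => congrArg Subtype.val (ht b))
  exact Subgroup.subgroupOf_eq_top.1 (top_le_iff.1 htop)

theorem IsFiniteResidual.finite_of_forall_fixed_eq_one (hφ : InnNormalized φ)
    (hR : IsFiniteResidual MulAut.conj R) (hL : IsNormalAdmissible φ L) [Finite L]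
    (htop : hyperfixedModulo φ L = ⊤) (hfix : ∀ x, (∀ b, φ b x = x) → x = 1) : Finite G := by
  have := hR.finite
  have := hR.isNormalAdmissible.normal
  have := hL.normal
  set K := fixedModulo (φ.comp R.subtype) ⊥ ⊓ Subgroup.centralizer (L : Set G)
  have hK : IsAdmissible φ K := fun b x hx =>
    ⟨isAdmissible_fixedModulo_comp_subtype b x hx.1,
      isAdmissible_centralizer hL.admissible b x hx.2⟩
  have hKfin : K.FiniteIndex := by
    have : (fixedModulo (φ.comp R.subtype) ⊥).FiniteIndex :=
      finiteIndex_fixedModulo_bot fun x r => hR.inv_mul_apply_mem hφ hL x (htop ▸ trivial) r r.2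
    have := finiteIndex_centralizer_of_finite (L := L)
    infer_instance
  have hKL : K ≤ L := by
    by_contra hne
    obtain ⟨x, hxK, hxL, hx⟩ :=
      exists_fixed_modulo_of_le_hyperfixedModulo hφ hL hK (by simp [htop]) hne
    exact hxL (inf_fixedModulo_le_of_forall_fixed_eq_one hφ hR.hyperfixedModulo_eq_top hL hK
      (fun x hx r hr => mem_fixedModulo_bot.1 hx.1 ⟨r, hr⟩) inf_le_right hfix
      ⟨hxK, (mem_fixedModulo hL.normal).2 hx⟩)
  have : Finite K := Finite.of_injective _ (Subgroup.inclusion_injective hKL)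
  exact (Subgroup.finite_iff_finite_and_finiteIndex K).2 ⟨this, hKfin⟩

theorem FiniteByHyperfixed.finiteIndex_hyperfixedModulo_bot (h : FiniteByHyperfixed φ ⊤)
    (hφ : InnNormalized φ) (hR : IsFiniteResidual MulAut.conj R) :
    (hyperfixedModulo φ ⊥).FiniteIndex := by
  obtain ⟨L, hL, hfin, htop⟩ := h
  have hN : IsNormalAdmissible φ (hyperfixedModulo φ ⊥) := isNormalAdmissible_hyperfixedModulo
  have := hN.normal
  have hf := isSemiEquivariant_mk' φ _ hN.admissible
  have hs := QuotientGroup.mk'_surjective (hyperfixedModulo φ ⊥)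
  have : Finite (L.map (QuotientGroup.mk' (hyperfixedModulo φ ⊥))) := Finite.Set.finite_image _ _
  have htop' : hyperfixedModulo (quotientOperators φ _ hN.admissible)
      (L.map (QuotientGroup.mk' (hyperfixedModulo φ ⊥))) = ⊤ := by
    apply Subgroup.comap_injective hs
    rw [hf.comap_hyperfixedModulo hs, Subgroup.comap_top]
    exact top_le_iff.1 (htop.trans (hyperfixedModulo_mono (Subgroup.le_comap_map _ _)))
  have : Finite (G ⧸ hyperfixedModulo φ ⊥) := by
    refine hR.finite_of_forall_fixed_eq_one (hf.innNormalized hs hφ)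
      (hf.isNormalAdmissible_map hs hL) htop' fun x hx => ?_
    induction x using QuotientGroup.induction_on with
    | H g =>
      rw [QuotientGroup.eq_one_iff]
      exact isFixedClosed_hyperfixedModulo g fun b => QuotientGroup.eq.1 (hx b).symm
  exact Subgroup.finiteIndex_of_finite_quotient

end FixedPointFree

section Periodic

theorem apply_mem_periodicPts_of_mapsTo {α : Type*} {f g : α → α} {s : Set α}
    (hf : Set.MapsTo f s s) (hcomm : ∀ x ∈ s, f (g x) = g (f x)) {x : α} (hx : x ∈ s)
    (hper : x ∈ Function.periodicPts f) : g x ∈ Function.periodicPts f := by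
  obtain ⟨n, hn, hnx⟩ := hper
  have hiter : ∀ i, f^[i] (g x) = g (f^[i] x) := fun i => by
    induction i with
    | zero => rfl
    | succ i ih =>
      rw [Function.iterate_succ_apply', Function.iterate_succ_apply', ih, hcomm _ (hf.iterate i hx)]
  exact ⟨n, hn, (hiter n).trans (congrArg g hnx)⟩

variable {X : Type*} [CommGroup X]

/-- The periodic points of an endomorphism of a commutative group. -/
def periodicSubgroup (δ : X →* X) : Subgroup X where
  carrier := Function.periodicPts δ
  one_mem' := Function.mk_mem_periodicPts one_pos (map_one δ)
  mul_mem' {x y} := by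
    rintro ⟨m, hm, hx⟩ ⟨n, hn, hy⟩
    refine ⟨m * n, Nat.mul_pos hm hn, ?_⟩
    rw [Function.IsPeriodicPt, Function.IsFixedPt, iterate_map_mul, hx.mul_const n, hy.const_mul m]
  inv_mem' {x} := by
    rintro ⟨m, hm, hx⟩
    refine ⟨m, hm, ?_⟩
    rw [Function.IsPeriodicPt, Function.IsFixedPt, iterate_map_inv, hx]

variable {δ : X →* X} {M T : Subgroup X} {x : X}

theorem eq_one_of_mem_periodicSubgroup (hx : x ∈ periodicSubgroup δ) {n : ℕ}
    (hn : δ^[n] x = 1) : x = 1 := by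
  obtain ⟨k, hk, hx⟩ := hx
  have hle : n ≤ n * k := Nat.le_mul_of_pos_right n hk
  rw [← hx.const_mul n, ← Nat.sub_add_cancel hle, Function.iterate_add_apply, hn, iterate_map_one]

theorem mem_of_iterate_mem (hM : Set.MapsTo δ M M) (hinj : ∀ x ∈ M, δ x ∈ T → x ∈ T) (n : ℕ)
    (hx : x ∈ M) (hn : δ^[n] x ∈ T) : x ∈ T := by
  induction n with
  | zero => exact hn
  | succ n ih =>
    rw [Function.iterate_succ_apply'] at hn
    exact ih (hinj _ (hM.iterate n hx) hn)

theorem exists_inv_mul_iterate_mem [T.IsFiniteRelIndex M] (hM : Set.MapsTo δ M M)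
    (hinj : ∀ x ∈ M, δ x ∈ T → x ∈ T) (hx : x ∈ M) : ∃ k > 0, x⁻¹ * δ^[k] x ∈ T := by
  have := Subgroup.IsFiniteRelIndex.to_finiteIndex_subgroupOf (H := T) (K := M)
  obtain ⟨i, j, hij, h⟩ := Finite.exists_ne_map_eq_of_infinite
    (fun i : ℕ => ((⟨δ^[i] x, hM.iterate i hx⟩ : M) : M ⧸ T.subgroupOf M))
  wlog hlt : i < j generalizing i j
  · exact this j i hij.symm h.symm (lt_of_le_of_ne (not_lt.1 hlt) hij.symm)
  refine ⟨j - i, Nat.sub_pos_of_lt hlt,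
    mem_of_iterate_mem hM hinj i (M.mul_mem (M.inv_mem hx) (hM.iterate _ hx)) ?_⟩
  rw [iterate_map_mul, iterate_map_inv, ← Function.iterate_add_apply, Nat.add_sub_cancel' hlt.le]
  simpa [Subgroup.mem_subgroupOf] using QuotientGroup.eq.1 h

/-- Fitting's lemma for an endomorphism that is nilpotent on `T` and injective modulo `T`. -/
theorem le_sup_periodicSubgroup [T.IsFiniteRelIndex M] (hM : Set.MapsTo δ M M)
    (hinj : ∀ x ∈ M, δ x ∈ T → x ∈ T) (hnil : ∀ x ∈ T, ∃ n, δ^[n] x = 1) :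
    M ≤ T ⊔ (M ⊓ periodicSubgroup δ) := by
  intro x hx
  obtain ⟨k, hk, hkx⟩ := exists_inv_mul_iterate_mem hM hinj hx
  obtain ⟨n, hn⟩ := hnil _ hkx
  have hper : Function.IsPeriodicPt δ k (δ^[n] x) := by
    rw [iterate_map_mul, iterate_map_inv, inv_mul_eq_one, ← Function.iterate_add_apply, add_comm,
      Function.iterate_add_apply] at hn
    exact hn.symm
  have hle : n ≤ n * k := Nat.le_mul_of_pos_right n hk
  have hp : δ^[n * k] x ∈ M ⊓ periodicSubgroup δ := by
    refine ⟨hM.iterate _ hx, k, hk, ?_⟩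
    rw [← Nat.sub_add_cancel hle, Function.iterate_add_apply]
    exact hper.apply_iterate _
  have ht : x⁻¹ * δ^[n * k] x ∈ T := by
    refine mem_of_iterate_mem hM hinj n (M.mul_mem (M.inv_mem hx) hp.1) ?_
    rw [iterate_map_mul, iterate_map_inv, ← Function.iterate_add_apply, add_comm,
      Function.iterate_add_apply, hper.const_mul n, inv_mul_cancel]
    exact T.one_mem
  simpa using Subgroup.mul_mem_sup (T.inv_mem ht) hp

end Periodic

section FiniteSupplement

variable {X B : Type*} [CommGroup X] [Group B] {φ : B →* MulAut X} {M T : Subgroup X}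
  {N : Subgroup B} {a q : B} {x : X}

theorem innNormalized_of_comm : InnNormalized φ := fun g b => ⟨b, by ext x; simp⟩

theorem IsAdmissible.isNormalAdmissible (hM : IsAdmissible φ M) : IsNormalAdmissible φ M :=
  ⟨inferInstance, hM⟩

theorem exists_iterate_displacement_eq_one (b : B) :
    ∀ x ∈ hyperfixedModulo φ ⊥, ∃ n, (displacement φ b)^[n] x = 1 := by
  refine hyperfixedModulo_induction innNormalized_of_comm .bot _ (fun x hx => ⟨0, hx⟩) ?_
  intro N _ _ hN x hx
  obtain ⟨n, hn⟩ := hN _ (hx b)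
  exact ⟨n + 1, hn⟩

/-- The factor `M / T` is trivial or irreducible under the operators. -/
structure IsIrreducibleFactor (φ : B →* MulAut X) (T M : Subgroup X) : Prop where
  admissible_bot : IsAdmissible φ T
  admissible_top : IsAdmissible φ M
  le : T ≤ M
  eq_or_eq : ∀ S, IsAdmissible φ S → T ≤ S → S ≤ M → S = T ∨ S = M

/-- The elements of `M` that are periodic under the displacement by `b`. -/
def periodicPart (φ : B →* MulAut X) (M : Subgroup X) (b : B) : Subgroup X :=
  M ⊓ periodicSubgroup (displacement φ b)

theorem eq_one_of_mem_periodicPart (hT : T ≤ hyperfixedModulo φ ⊥) (hxT : x ∈ T)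
    (hx : x ∈ periodicPart φ M a) : x = 1 := by
  obtain ⟨n, hn⟩ := exists_iterate_displacement_eq_one a x (hT hxT)
  exact eq_one_of_mem_periodicSubgroup hx.2 hn

theorem finite_periodicPart [T.IsFiniteRelIndex M] (hT : T ≤ hyperfixedModulo φ ⊥) :
    Finite (periodicPart φ M a) := by
  have : T.IsFiniteRelIndex (periodicPart φ M a) :=
    Subgroup.isFiniteRelIndex_of_le_right T (L := M) inf_le_left
  have hbot : T.subgroupOf (periodicPart φ M a) = ⊥ :=
    eq_bot_iff.2 fun x hx => Subtype.ext (eq_one_of_mem_periodicPart hT hx x.2)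
  have hcard := this.relIndex_ne_zero
  rw [Subgroup.relIndex, hbot, Subgroup.index_bot] at hcard
  exact Nat.finite_of_card_ne_zero hcard

theorem mapsTo_displacement_periodicPart (hM : IsAdmissible φ M) :
    Set.MapsTo (displacement φ a) (periodicPart φ M a) (periodicPart φ M a) := fun _ hx =>
  ⟨hM.inv_mul_apply_mem hx.1 a, (Function.Semiconj.mapsTo_periodicPts (fun _ => rfl)) hx.2⟩

theorem apply_apply_comm (hq : ∀ b, q⁻¹ * (b * q * b⁻¹) ∈ N) (hN : ∀ c ∈ N, φ c x = x) (b : B) :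
    φ q (φ b x) = φ b (φ q x) := by
  simpa [displacement_apply] using displacement_apply_comm hq hN b

theorem apply_mem_periodicPart (hM : IsAdmissible φ M) (hx : x ∈ periodicPart φ M a)
    (hq : ∀ b, q⁻¹ * (b * q * b⁻¹) ∈ N) (hN : ∀ c ∈ N, ∀ y ∈ periodicPart φ M a, φ c y = y) :
    φ q x ∈ periodicPart φ M a := by
  refine ⟨hM q x hx.1, apply_mem_periodicPts_of_mapsTo (g := φ q)
    (mapsTo_displacement_periodicPart hM) (fun y hy => ?_) hx hx.2⟩
  rw [displacement_apply, displacement_apply, map_mul, map_inv,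
    apply_apply_comm hq (fun c hc => hN c hc y hy)]

namespace IsIrreducibleFactor

theorem mem_of_displacement_mem (h : IsIrreducibleFactor φ T M)
    (ha : a ∉ centralizerModulo φ M T h.admissible_bot)
    (hcomm : ∀ b, a⁻¹ * (b * a * b⁻¹) ∈ centralizerModulo φ M T h.admissible_bot) :
    ∀ x ∈ M, displacement φ a x ∈ T → x ∈ T := by
  set S := M ⊓ T.comap (displacement φ a)
  have hS : IsAdmissible φ S := fun b x hx => by
    refine ⟨h.admissible_top b x hx.1, ?_⟩
    have := T.mul_mem (h.admissible_bot b _ hx.2)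
      (inv_apply_displacement_mul_displacement_apply_mem h.admissible_bot hcomm
        (fun c hc => hc x hx.1) b)
    rwa [mul_inv_cancel_left] at this
  have hTS : T ≤ S := le_inf h.le fun x hx => h.admissible_bot.inv_mul_apply_mem hx a
  rcases h.eq_or_eq S hS hTS inf_le_left with hST | hSM
  · exact fun x hx hxT => hST ▸ ⟨hx, hxT⟩
  · exact absurd (fun x hx => (hSM.ge hx).2) ha

theorem le_sup_periodicPart (h : IsIrreducibleFactor φ T M) [T.IsFiniteRelIndex M]
    (hT : T ≤ hyperfixedModulo φ ⊥) (ha : a ∉ centralizerModulo φ M T h.admissible_bot)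
    (hcomm : ∀ b, a⁻¹ * (b * a * b⁻¹) ∈ centralizerModulo φ M T h.admissible_bot) :
    M ≤ T ⊔ periodicPart φ M a :=
  le_sup_periodicSubgroup (fun _ hx => h.admissible_top.inv_mul_apply_mem hx a)
    (h.mem_of_displacement_mem ha hcomm)
    fun x hx => exists_iterate_displacement_eq_one a x (hT hx)

theorem periodicPart_le_periodicPart (h : IsIrreducibleFactor φ T M) [T.IsFiniteRelIndex M]
    (hT : T ≤ hyperfixedModulo φ ⊥) (hq : q ∉ centralizerModulo φ M T h.admissible_bot)
    (hcomm : ∀ b, q⁻¹ * (b * q * b⁻¹) ∈ centralizerModulo φ M T h.admissible_bot)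
    (hmaps : Set.MapsTo (displacement φ q) (periodicPart φ M a) (periodicPart φ M a)) :
    periodicPart φ M a ≤ periodicPart φ M q := fun x hx => by
  have := finite_periodicPart (a := a) (M := M) hT
  have : (⊥ : Subgroup X).IsFiniteRelIndex (periodicPart φ M a) := by
    rw [Subgroup.isFiniteRelIndex_iff_relIndex_ne_zero, Subgroup.relIndex_bot_left]
    exact Nat.card_pos.ne'
  have hinj : ∀ y ∈ periodicPart φ M a, displacement φ q y ∈ (⊥ : Subgroup X) →
      y ∈ (⊥ : Subgroup X) := fun y hy hy1 => Subgroup.mem_bot.2 <|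
    eq_one_of_mem_periodicPart hT
      (h.mem_of_displacement_mem hq hcomm y hy.1 (Subgroup.mem_bot.1 hy1 ▸ T.one_mem)) hy
  obtain ⟨k, hk, hkx⟩ := exists_inv_mul_iterate_mem hmaps hinj hx
  exact ⟨hx.1, k, hk, (inv_mul_eq_one.1 hkx).symm⟩

theorem isAdmissible_periodicPart (h : IsIrreducibleFactor φ T M) [T.IsFiniteRelIndex M]
    (hT : T ≤ hyperfixedModulo φ ⊥) (hsup : M ≤ T ⊔ periodicPart φ M a)
    (hN : ∀ c ∈ N, ∀ y ∈ periodicPart φ M a, φ c y = y) (hq : ∀ b, q⁻¹ * (b * q * b⁻¹) ∈ N)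
    (hqa : ¬ ∀ y ∈ periodicPart φ M a, φ q y = y) : IsAdmissible φ (periodicPart φ M a) := by
  have hqP : ∀ y ∈ periodicPart φ M a, φ q y ∈ periodicPart φ M a := fun y hy =>
    apply_mem_periodicPart h.admissible_top hy hq hN
  have hNC : ∀ c ∈ N, c ∈ centralizerModulo φ M T h.admissible_bot := fun c hc m hm => by
    obtain ⟨t, ht, l, hl, rfl⟩ := Subgroup.mem_sup.1 (hsup hm)
    rw [map_mul, hN c hc l hl, mul_inv, mul_mul_mul_comm, inv_mul_cancel, mul_one]
    exact h.admissible_bot.inv_mul_apply_mem ht c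
  have hqC : q ∉ centralizerModulo φ M T h.admissible_bot := fun hqC => hqa fun y hy =>
    (inv_mul_eq_one.1 (eq_one_of_mem_periodicPart hT (hqC y hy.1)
      (mul_mem (inv_mem hy) (hqP y hy)))).symm
  have hmaps : Set.MapsTo (displacement φ q) (periodicPart φ M a) (periodicPart φ M a) :=
    fun y hy => mul_mem (inv_mem hy) (hqP y hy)
  have hle : periodicPart φ M a ≤ periodicPart φ M q :=
    h.periodicPart_le_periodicPart hT hqC (fun b => hNC _ (hq b)) hmaps
  -- `q` commutes with the operators on the periodic part of `a`, so they map it into the periodic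
  -- part of `q`, which exceeds it by nothing, as it meets `T` trivially.
  intro b x hx
  have hbx : φ b x ∈ periodicPart φ M q := ⟨h.admissible_top b x hx.1,
    apply_mem_periodicPts_of_mapsTo hmaps
      (fun y hy => displacement_apply_comm hq (fun c hc => hN c hc y hy) b) hx (hle hx).2⟩
  obtain ⟨t, ht, l, hl, htl⟩ := Subgroup.mem_sup.1 (hsup hbx.1)
  have ht1 : t = 1 := eq_one_of_mem_periodicPart (M := M) (a := q) hT ht <| by
    rw [eq_mul_inv_of_mul_eq htl]
    exact mul_mem hbx (inv_mem (hle hl))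
  rwa [← htl, ht1, one_mul]

theorem exists_finite_supplement (h : IsIrreducibleFactor φ T M) [T.IsFiniteRelIndex M]
    (hker : hyperfixedModulo MulAut.conj φ.ker = ⊤) (hT : T ≤ hyperfixedModulo φ ⊥)
    (hne : centralizerModulo φ M T h.admissible_bot ≠ ⊤) :
    ∃ L, IsAdmissible φ L ∧ Finite L ∧ M ≤ T ⊔ L := by
  obtain ⟨a, ha, hcomm⟩ := exists_central_modulo hker
    (normal_centralizerModulo h.admissible_bot h.admissible_top)
    (ker_le_centralizerModulo _ h.admissible_bot) hne
  have hsup := h.le_sup_periodicPart hT ha hcomm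
  refine ⟨periodicPart φ M a, ?_, finite_periodicPart hT, hsup⟩
  obtain ⟨N, -, hN, -, htop | ⟨q, hq, hqa⟩⟩ :=
    exists_maximal_isNormalAdmissible_forall innNormalized_conj
      (isNormalAdmissible_conj_iff.2 (inferInstance : φ.ker.Normal))
      (fun b => ∀ y ∈ periodicPart φ M a, φ b y = y)
      (fun b hb y _ => by simp [MonoidHom.mem_ker.1 hb])
  · intro b y hy
    rwa [hN b (htop (hker ▸ trivial)) y hy]
  · exact h.isAdmissible_periodicPart hT hsup hN hq hqa

end IsIrreducibleFactor

end FiniteSupplement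

section Quotient

variable {G B : Type*} [Group G] [Group B] {φ : B →* MulAut G} {K N : Subgroup G} [N.Normal]
  {hN : IsAdmissible φ N}

theorem comap_hyperfixedModulo_quotientOperators :
    (hyperfixedModulo (quotientOperators φ N hN) ⊥).comap (QuotientGroup.mk' N) =
      hyperfixedModulo φ N := by
  rw [(isSemiEquivariant_mk' φ N hN).comap_hyperfixedModulo (QuotientGroup.mk'_surjective N),
    MonoidHom.comap_bot, QuotientGroup.ker_mk']

theorem index_hyperfixedModulo_quotientOperators :
    (hyperfixedModulo (quotientOperators φ N hN) ⊥).index = (hyperfixedModulo φ N).index := by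
  rw [← comap_hyperfixedModulo_quotientOperators (hN := hN),
    Subgroup.index_comap_of_surjective _ (QuotientGroup.mk'_surjective N)]

theorem finiteIndex_hyperfixedModulo_quotientOperators [(hyperfixedModulo φ ⊥).FiniteIndex] :
    (hyperfixedModulo (quotientOperators φ N hN) ⊥).FiniteIndex := by
  have : (hyperfixedModulo φ N).FiniteIndex :=
    Subgroup.finiteIndex_of_le (hyperfixedModulo_mono bot_le)
  exact ⟨index_hyperfixedModulo_quotientOperators.trans_ne this.index_ne_zero⟩

theorem FiniteByHyperfixed.of_quotientOperators [Finite N]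
    (h : FiniteByHyperfixed (quotientOperators φ N hN) (K.map (QuotientGroup.mk' N))) :
    FiniteByHyperfixed φ K := by
  have : Finite (QuotientGroup.mk' N).ker := by rwa [QuotientGroup.ker_mk']
  exact (h.comap (isSemiEquivariant_mk' φ N hN) (QuotientGroup.mk'_surjective N)).mono
    (Subgroup.le_comap_map _ _)

theorem ker_le_ker_quotientOperators : φ.ker ≤ (quotientOperators φ N hN).ker := fun b hb => by
  ext x
  induction x using QuotientGroup.induction_on with
  | H g => exact congrArg _ (DFunLike.congr_fun hb g)

theorem finite_setOf_le [N.FiniteIndex] : {K : Subgroup G | N ≤ K}.Finite :=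
  Set.finite_coe_iff.1 (Finite.of_equiv _ (QuotientGroup.comapMk'OrderIso N).toEquiv)

end Quotient

section CommutativeByFinite

variable {B : Type*} [Group B]

theorem exists_isIrreducibleFactor {X : Type*} [CommGroup X] {φ : B →* MulAut X} {T : Subgroup X}
    [T.FiniteIndex] (hT : IsAdmissible φ T) (hne : T ≠ ⊤) :
    ∃ M, T < M ∧ IsIrreducibleFactor φ T M := by
  obtain ⟨M, hM⟩ := Set.Finite.exists_minimal (s := {M | IsAdmissible φ M ∧ T < M})
    (finite_setOf_le.subset fun M hM => hM.2.le) ⟨⊤, fun _ _ _ => trivial, hne.lt_top⟩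
  refine ⟨M, hM.prop.2, hT, hM.prop.1, hM.prop.2.le, fun S hS hTS hSM => ?_⟩
  rcases hTS.eq_or_lt with h | h
  · exact Or.inl h.symm
  · exact Or.inr (hSM.antisymm (hM.le_of_le ⟨hS, h⟩ hSM))

theorem exists_finite_lt_hyperfixedModulo {X : Type*} [CommGroup X] {φ : B →* MulAut X}
    (hker : hyperfixedModulo MulAut.conj φ.ker = ⊤) [(hyperfixedModulo φ ⊥).FiniteIndex]
    (hne : hyperfixedModulo φ ⊥ ≠ ⊤) :
    ∃ L, IsNormalAdmissible φ L ∧ Finite L ∧ hyperfixedModulo φ ⊥ < hyperfixedModulo φ L := by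
  obtain ⟨M, hTM, h⟩ :=
    exists_isIrreducibleFactor isNormalAdmissible_hyperfixedModulo.admissible hne
  have hC : centralizerModulo φ M _ h.admissible_bot ≠ ⊤ := fun htop =>
    hTM.not_ge fun x hx => isFixedClosed_hyperfixedModulo x fun b =>
      (htop ▸ Subgroup.mem_top b : b ∈ centralizerModulo φ M _ h.admissible_bot) x hx
  have : (hyperfixedModulo φ ⊥).IsFiniteRelIndex M := Subgroup.isFiniteRelIndex_of_finiteIndex
  obtain ⟨L, hL, hfin, hML⟩ := h.exists_finite_supplement hker le_rfl hC
  exact ⟨L, hL.isNormalAdmissible, hfin,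
    hTM.trans_le (hML.trans (sup_le (hyperfixedModulo_mono bot_le) le_hyperfixedModulo))⟩

theorem finiteByHyperfixed_top_of_hyperfixedModulo_ker {X : Type*} [CommGroup X]
    {φ : B →* MulAut X} (hker : hyperfixedModulo MulAut.conj φ.ker = ⊤)
    [(hyperfixedModulo φ ⊥).FiniteIndex] : FiniteByHyperfixed φ ⊤ := by
  induction hn : (hyperfixedModulo φ ⊥).index using Nat.strong_induction_on generalizing X with
  | _ n ih =>
  by_cases hne : hyperfixedModulo φ ⊥ = ⊤
  · exact hne ▸ .hyperfixedModulo_bot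
  obtain ⟨L, hL, hfin, hlt⟩ := exists_finite_lt_hyperfixedModulo hker hne
  have := finiteIndex_hyperfixedModulo_quotientOperators (hN := hL.admissible)
  have hquot : FiniteByHyperfixed (quotientOperators φ L hL.admissible) ⊤ := by
    refine ih _ ?_ ?_ rfl
    · rw [index_hyperfixedModulo_quotientOperators, ← hn]
      exact Subgroup.index_strictAnti hlt
    · exact top_le_iff.1 (hker.ge.trans (hyperfixedModulo_mono ker_le_ker_quotientOperators))
  exact .of_quotientOperators (hquot.mono le_top)

end CommutativeByFinite

section DisplacementSubgroup

variable {G B : Type*} [Group G] [Group B] {φ : B →* MulAut G} {K : Subgroup G} {R : Subgroup B}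

/-- The subgroup generated by the elements `x⁻¹ r(x)`, i.e. the commutator `[K, R]` in the
semidirect product of `G` and the group of operators. -/
def displacementSubgroup (φ : B →* MulAut G) (R : Subgroup B) (K : Subgroup G) : Subgroup G :=
  Subgroup.closure {y | ∃ x ∈ K, ∃ r ∈ R, x⁻¹ * φ r x = y}

theorem inv_mul_apply_mem_displacementSubgroup {x : G} (hx : x ∈ K) {r : B} (hr : r ∈ R) :
    x⁻¹ * φ r x ∈ displacementSubgroup φ R K :=
  Subgroup.subset_closure ⟨x, hx, r, hr, rfl⟩

theorem isNormalAdmissible_displacementSubgroup (hφ : InnNormalized (φ.comp R.subtype))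
    [hR : R.Normal] (hK : IsNormalAdmissible φ K) :
    IsNormalAdmissible φ (displacementSubgroup φ R K) := by
  refine .closure ?_ ?_
  · rintro _ ⟨x, hx, r, hr, rfl⟩ g
    obtain ⟨s, hs⟩ := hφ.exists_apply_eq g ⟨r, hr⟩
    have hs : ∀ x, φ s x = g * φ r (g⁻¹ * x * g) * g⁻¹ := hs
    exact ⟨g * x * g⁻¹, hK.conj_mem hx g, s, s.2, by rw [hs]; simp [mul_assoc]⟩
  · rintro _ ⟨x, hx, r, hr, rfl⟩ b
    exact ⟨φ b x, hK.admissible b x hx, b * r * b⁻¹, hR.conj_mem r hr b, by simp⟩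

theorem finite_displacementSubgroup_top {X : Type*} [CommGroup X] {φ : B →* MulAut X} [Finite R]
    [(fixedModulo (φ.comp R.subtype) ⊥).FiniteIndex] : Finite (displacementSubgroup φ R ⊤) := by
  set T := fixedModulo (φ.comp R.subtype) ⊥
  have := Fintype.ofFinite R
  let Φ : (R → X) →* X := ∏ r : R, (displacement φ (r : B)).comp (Pi.evalMonoidHom _ r)
  have hΦ : ∀ f, Φ f = ∏ r : R, displacement φ (r : B) (f r) := fun f => by simp [Φ]
  have hle : displacementSubgroup φ R ⊤ ≤ Φ.range := by
    classical
    rw [displacementSubgroup, Subgroup.closure_le]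
    rintro _ ⟨x, -, r, hr, rfl⟩
    refine ⟨Pi.mulSingle ⟨r, hr⟩ x, ?_⟩
    rw [hΦ, Finset.prod_eq_single ⟨r, hr⟩ (fun s _ hs => by simp [hs]) (by simp)]
    simp [displacement_apply]
  have hout : ∀ f, Φ (fun r => (f r : X ⧸ T).out) = Φ f := fun f => by
    rw [hΦ, hΦ]
    refine Finset.prod_congr rfl fun r _ => ?_
    obtain ⟨⟨t, ht⟩, h⟩ := QuotientGroup.mk_out_eq_mul T (f r)
    have ht1 : displacement φ (r : B) t = 1 :=
      inv_mul_eq_one.2 (mem_fixedModulo_bot.1 ht r).symm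
    rw [h, map_mul, ht1, mul_one]
  have hfin : (Φ.range : Set X).Finite :=
    (Set.finite_range fun f : R → X ⧸ T => Φ fun r => (f r).out).subset <| by
      rintro _ ⟨f, rfl⟩
      exact ⟨fun r => f r, hout f⟩
  exact (hfin.subset hle).to_subtype

theorem finiteByHyperfixed_top_of_commGroup {X : Type*} [CommGroup X] {φ : B →* MulAut X}
    (hR : IsFiniteResidual MulAut.conj R) [(hyperfixedModulo φ ⊥).FiniteIndex] :
    FiniteByHyperfixed φ ⊤ := by
  have := hR.finite
  have := hR.isNormalAdmissible.normal
  have : (fixedModulo (φ.comp R.subtype) ⊥).FiniteIndex :=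
    Subgroup.finiteIndex_of_le (H := hyperfixedModulo φ ⊥) fun x hx =>
      Subgroup.subset_closure fun r => hR.inv_mul_apply_mem innNormalized_of_comm .bot x hx r r.2
  have := finite_displacementSubgroup_top (φ := φ) (R := R)
  have hW : IsNormalAdmissible φ (displacementSubgroup φ R ⊤) :=
    isNormalAdmissible_displacementSubgroup innNormalized_of_comm .top
  have := finiteIndex_hyperfixedModulo_quotientOperators (hN := hW.admissible)
  have hker : R ≤ (quotientOperators φ _ hW.admissible).ker := fun r hr => by
    ext x
    induction x using QuotientGroup.induction_on with
    | H x =>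
      exact (QuotientGroup.eq.2
        (inv_mul_apply_mem_displacementSubgroup (Subgroup.mem_top x) hr)).symm
  have hquot : FiniteByHyperfixed (quotientOperators φ _ hW.admissible) ⊤ :=
    finiteByHyperfixed_top_of_hyperfixedModulo_ker
      (top_le_iff.1 (hR.hyperfixedModulo_eq_top.ge.trans (hyperfixedModulo_mono hker)))
  exact .of_quotientOperators (hquot.mono le_top)

end DisplacementSubgroup

section CentralByFinite

open scoped commutatorElement

variable {G B : Type*} [Group G] [Group B] {φ : B →* MulAut G}

theorem finite_commutator_of_finiteIndex_center [(Subgroup.center G).FiniteIndex] :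
    Finite (commutator G) := by
  have hfin : (commutatorSet G).Finite := by
    refine (Set.finite_range fun p : (G ⧸ Subgroup.center G) × (G ⧸ Subgroup.center G) =>
      ⁅p.1.out, p.2.out⁆).subset ?_
    rintro _ ⟨v, w, rfl⟩
    obtain ⟨⟨l, hl⟩, hv⟩ := QuotientGroup.mk_out_eq_mul (Subgroup.center G) v
    obtain ⟨⟨m, hm⟩, hw⟩ := QuotientGroup.mk_out_eq_mul (Subgroup.center G) w
    refine ⟨(v, w), ?_⟩
    rw [Subgroup.mem_center_iff] at hl hm
    simp only [hv, hw]
    exact commutatorElement_mul_mul_eq (hl w).symm (hl m).symm (hm v)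
  have := hfin.to_subtype
  infer_instance

theorem finiteByHyperfixed_top_of_finiteIndex_center {R : Subgroup B}
    (hR : IsFiniteResidual MulAut.conj R) [(Subgroup.center G).FiniteIndex]
    [(hyperfixedModulo φ ⊥).FiniteIndex] : FiniteByHyperfixed φ ⊤ := by
  have := finite_commutator_of_finiteIndex_center (G := G)
  have hN : IsAdmissible φ (commutator G) := fun b x hx =>
    Subgroup.characteristic_iff_le_comap.1 inferInstance (φ b) hx
  let _ : CommGroup (G ⧸ commutator G) := inferInstanceAs (CommGroup (Abelianization G))
  have := finiteIndex_hyperfixedModulo_quotientOperators (hN := hN)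
  have hquot : FiniteByHyperfixed (quotientOperators φ _ hN) ⊤ :=
    finiteByHyperfixed_top_of_commGroup hR
  exact .of_quotientOperators (hquot.mono le_top)

end CentralByFinite

section Restriction

variable {G B : Type*} [Group G] [Group B] {φ : B →* MulAut G} {M : Subgroup G}

theorem innNormalized_restrictOperators (hφ : InnNormalized φ) (hM : IsAdmissible φ M) :
    InnNormalized (restrictOperators φ M hM) := by
  intro g b
  obtain ⟨c, hc⟩ := hφ.exists_apply_eq g b
  exact ⟨c, MulEquiv.ext fun x => Subtype.ext (hc x)⟩

theorem subgroupOf_hyperfixedModulo_le (hφ : InnNormalized φ) (hM : IsAdmissible φ M) :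
    (hyperfixedModulo φ ⊥).subgroupOf M ≤ hyperfixedModulo (restrictOperators φ M hM) ⊥ := by
  suffices ∀ x ∈ hyperfixedModulo φ ⊥, ∀ hx : x ∈ M,
      (⟨x, hx⟩ : M) ∈ hyperfixedModulo (restrictOperators φ M hM) ⊥ from fun x hx => this x hx x.2
  refine hyperfixedModulo_induction hφ .bot _ (fun x hx hxM => le_hyperfixedModulo (Subtype.ext hx))
    fun N _ _ hN x hx hxM => isFixedClosed_hyperfixedModulo _ fun b =>
      hN _ (hx b) (hM.inv_mul_apply_mem hxM b)

theorem InnNormalized.isSemiEquivariant_conjNormal (hφ : InnNormalized φ) [M.Normal]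
    (hM : IsAdmissible φ M) (g : G) :
    IsSemiEquivariant (restrictOperators φ M hM) (restrictOperators φ M hM)
      (MulAut.conjNormal g : MulAut M).toMonoidHom where
  exists_right b := by
    obtain ⟨c, hc⟩ := (hφ.isSemiEquivariant_conj g).exists_right b
    exact ⟨c, fun x => Subtype.ext (hc x)⟩
  exists_left c := by
    obtain ⟨b, hb⟩ := (hφ.isSemiEquivariant_conj g).exists_left c
    exact ⟨b, fun x => Subtype.ext (hb x)⟩

theorem FiniteByHyperfixed.of_restrictOperators (hφ : InnNormalized φ)
    (hM : IsNormalAdmissible φ M)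
    (h : FiniteByHyperfixed (restrictOperators φ M hM.admissible) ⊤) : FiniteByHyperfixed φ M := by
  have := hM.normal
  obtain ⟨S, hS⟩ := h.exists_isFiniteResidual
  have := hS.finite
  refine ⟨S.map M.subtype, ⟨⟨?_⟩, ?_⟩, Finite.Set.finite_image _ _, fun x hx => ?_⟩
  · rintro _ ⟨s, hs, rfl⟩ g
    exact ⟨_, hS.apply_mem (innNormalized_restrictOperators hφ _)
      (hφ.isSemiEquivariant_conjNormal _ g) (MulEquiv.surjective _) hs, MulAut.conjNormal_apply g s⟩
  · rintro b _ ⟨s, hs, rfl⟩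
    exact ⟨_, hS.isNormalAdmissible.admissible b s hs, rfl⟩
  · refine (isSemiEquivariant_subtype φ M hM.admissible).hyperfixedModulo_le_comap (L := S)
      ((Subgroup.le_comap_map _ _).trans (Subgroup.comap_mono le_hyperfixedModulo))
      (x := ⟨x, hx⟩) ?_
    rw [hS.hyperfixedModulo_eq_top]
    exact Subgroup.mem_top _

end Restriction

section InnerOperators

variable {G B : Type*} [Group G] [Group B] {φ : B →* MulAut G} {K L : Subgroup G} {R : Subgroup B}

/-- The subgroup of those elements of `K` that act on `G` by conjugation as an operator in `R`. -/
def innerOperators (φ : B →* MulAut G) (R : Subgroup B) (K : Subgroup G) : Subgroup G :=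
  K ⊓ (R.map φ).comap MulAut.conj

theorem conj_mulAut_apply (α : MulAut G) (x : G) :
    MulAut.conj (α x) = α * MulAut.conj x * α⁻¹ := by
  ext y
  simp

theorem isNormalAdmissible_innerOperators (hφ : InnNormalized (φ.comp R.subtype)) [hR : R.Normal]
    (hK : IsNormalAdmissible φ K) : IsNormalAdmissible φ (innerOperators φ R K) where
  normal := ⟨by
    rintro x ⟨hx, r, hr, hrx⟩ g
    obtain ⟨s, hs⟩ := hφ g ⟨r, hr⟩
    exact ⟨hK.conj_mem hx g, s, s.2, hs.trans (by simp [hrx])⟩⟩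
  admissible := by
    rintro b x ⟨hx, r, hr, hrx⟩
    exact ⟨hK.admissible b x hx, b * r * b⁻¹, hR.conj_mem r hr b, by
      simp [conj_mulAut_apply, hrx]⟩

theorem le_hyperfixedModulo_innerOperators_top (hφ : InnNormalized φ) (hK : IsAdmissible φ K) :
    K ≤ hyperfixedModulo φ (innerOperators φ ⊤ K) := fun x hx =>
  isFixedClosed_hyperfixedModulo x fun b => le_hyperfixedModulo <| by
    obtain ⟨c, hc⟩ := hφ x⁻¹ b
    refine ⟨hK.inv_mul_apply_mem hx b, c * b⁻¹, trivial, ?_⟩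
    simp [conj_mulAut_apply, hc, mul_assoc]

theorem IsFiniteResidual.innerOperators_top_le (hR : IsFiniteResidual MulAut.conj R)
    (hK : IsAdmissible φ K) :
    innerOperators φ ⊤ K ≤ hyperfixedModulo φ (innerOperators φ R K) := by
  have key : ∀ b ∈ hyperfixedModulo MulAut.conj R, ∀ y ∈ K, φ b = MulAut.conj y →
      y ∈ hyperfixedModulo φ (innerOperators φ R K) := by
    refine hyperfixedModulo_induction innNormalized_conj hR.isNormalAdmissible _
      (fun r hr y hy hry => le_hyperfixedModulo ⟨hy, r, hr, hry⟩) fun N _ _ hN b hb y hy hby =>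
      isFixedClosed_hyperfixedModulo y fun a => hN _ (hb a) _ (hK.inv_mul_apply_mem hy a) ?_
    simp [conj_mulAut_apply, hby]
  rintro y ⟨hy, b, -, hby⟩
  exact key b (hR.hyperfixedModulo_eq_top ▸ Subgroup.mem_top b) y hy hby

theorem finiteIndex_center_innerOperators [Finite R] :
    (Subgroup.center (innerOperators φ R K)).FiniteIndex := by
  set M := innerOperators φ R K
  have hle : (MulAut.conj.comp M.subtype : M →* MulAut G).range ≤ R.map φ := by
    rintro _ ⟨x, rfl⟩
    exact x.2.2
  have : Finite (R.map φ) := Finite.Set.finite_image _ _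
  have : Finite (MulAut.conj.comp M.subtype : M →* MulAut G).range :=
    Finite.of_injective _ (Subgroup.inclusion_injective hle)
  have := Subgroup.finiteIndex_ker (MulAut.conj.comp M.subtype : M →* MulAut G)
  refine Subgroup.finiteIndex_of_le (H := (MulAut.conj.comp M.subtype : M →* MulAut G).ker)
    fun x hx => Subgroup.mem_center_iff.2 fun y => Subtype.ext ?_
  exact (mul_inv_eq_iff_eq_mul.1 (DFunLike.congr_fun hx (y : G))).symm

theorem IsFiniteResidual.finiteByHyperfixed_of_hyperfixedModulo_bot (hφ : InnNormalized φ)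
    (hφR : InnNormalized (φ.comp R.subtype)) (hR : IsFiniteResidual MulAut.conj R)
    (hK : IsNormalAdmissible φ K) [(hyperfixedModulo φ ⊥).IsFiniteRelIndex K] :
    FiniteByHyperfixed φ K := by
  have := hR.finite
  have := hR.isNormalAdmissible.normal
  have hM := isNormalAdmissible_innerOperators hφR hK
  set M := innerOperators φ R K
  have : (Subgroup.center M).FiniteIndex := finiteIndex_center_innerOperators
  have : (hyperfixedModulo φ ⊥).IsFiniteRelIndex M :=
    Subgroup.isFiniteRelIndex_of_le_right _ (inf_le_left : M ≤ K)
  have : (hyperfixedModulo (restrictOperators φ M hM.admissible) ⊥).FiniteIndex :=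
    Subgroup.finiteIndex_of_le (subgroupOf_hyperfixedModulo_le hφ hM.admissible)
  have hMfin : FiniteByHyperfixed φ M :=
    .of_restrictOperators hφ hM (finiteByHyperfixed_top_of_finiteIndex_center hR)
  have hinner : FiniteByHyperfixed φ (innerOperators φ ⊤ K) :=
    hMfin.of_le_hyperfixedModulo (hR.innerOperators_top_le hK.admissible)
  exact hinner.of_le_hyperfixedModulo (le_hyperfixedModulo_innerOperators_top hφ hK.admissible)

theorem IsFiniteResidual.finiteByHyperfixed (hφ : InnNormalized φ)
    (hφR : InnNormalized (φ.comp R.subtype)) (hR : IsFiniteResidual MulAut.conj R)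
    (hK : IsNormalAdmissible φ K) (hL : IsNormalAdmissible φ L) [Finite L]
    [h : (hyperfixedModulo φ L).IsFiniteRelIndex K] : FiniteByHyperfixed φ K := by
  have := hL.normal
  have hs := QuotientGroup.mk'_surjective L
  have hf := isSemiEquivariant_mk' φ L hL.admissible
  have hfR : IsSemiEquivariant (φ.comp R.subtype)
      ((quotientOperators φ L hL.admissible).comp R.subtype) (QuotientGroup.mk' L) :=
    .of_equivariant fun _ _ => rfl
  have : (hyperfixedModulo (quotientOperators φ L hL.admissible) ⊥).IsFiniteRelIndex
      (K.map (QuotientGroup.mk' L)) := by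
    rw [Subgroup.isFiniteRelIndex_iff_relIndex_ne_zero, ← Subgroup.relIndex_comap,
      comap_hyperfixedModulo_quotientOperators]
    exact h.relIndex_ne_zero
  exact .of_quotientOperators (hR.finiteByHyperfixed_of_hyperfixedModulo_bot
    (hf.innNormalized hs hφ) (hfR.innNormalized hs hφR) (hf.isNormalAdmissible_map hs hK))

end InnerOperators

section Hypercentral

theorem isSemiEquivariant_conj_of_surjective {H H' : Type*} [Group H] [Group H'] {f : H →* H'}
    (hs : Function.Surjective f) : IsSemiEquivariant MulAut.conj MulAut.conj f :=
  ⟨fun b => ⟨f b, fun x => by simp⟩, fun c => by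
    obtain ⟨b, rfl⟩ := hs c
    exact ⟨b, fun x => by simp⟩⟩

variable {H : Type u} [Group H]

theorem centerStep_le_hyperfixedModulo {N : {N : Subgroup H // N.Normal}}
    (hN : N.1 ≤ hyperfixedModulo MulAut.conj ⊥) :
    (centerStep N).1 ≤ hyperfixedModulo MulAut.conj ⊥ := by
  have := N.2
  intro x hx
  refine isFixedClosed_hyperfixedModulo x fun b => hN ?_
  have hcomm : (b : H ⧸ N.1) * x = x * b := Subgroup.mem_center_iff.1 (Subgroup.mem_comap.1 hx) b
  exact QuotientGroup.eq.1 (eq_mul_inv_of_mul_eq hcomm.symm)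

theorem transfiniteCenter_le_hyperfixedModulo (α : Ordinal.{u}) :
    transfiniteCenter H α ≤ hyperfixedModulo MulAut.conj ⊥ := by
  unfold transfiniteCenter
  induction α using Ordinal.limitRecOn with
  | zero =>
    rw [transfiniteCenterAux, Ordinal.limitRecOn_zero]
    exact bot_le
  | add_one α ih =>
    rw [transfiniteCenterAux, Ordinal.limitRecOn_add_one]
    exact centerStep_le_hyperfixedModulo ih
  | limit l hl ih =>
    rw [transfiniteCenterAux, Ordinal.limitRecOn_limit _ _ _ _ hl]
    exact iSup_le fun b => ih b.1 b.2

theorem IsFiniteByHypercentral.finiteByHyperfixed_top (h : IsFiniteByHypercentral H) :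
    FiniteByHyperfixed (MulAut.conj : H →* MulAut H) ⊤ := by
  obtain ⟨F, hF, hfin, α, hα⟩ := h
  have hs := QuotientGroup.mk'_surjective F
  have : Finite (QuotientGroup.mk' F).ker := by rwa [QuotientGroup.ker_mk']
  have hquot : FiniteByHyperfixed (MulAut.conj : H ⧸ F →* MulAut (H ⧸ F)) ⊤ :=
    FiniteByHyperfixed.hyperfixedModulo_bot.mono
      (hα.ge.trans (transfiniteCenter_le_hyperfixedModulo α))
  exact hquot.comap (isSemiEquivariant_conj_of_surjective hs) hs

end Hypercentral

section FixedSeries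

variable {G B : Type u} [Group G] [Group B] {φ : B →* MulAut G}

/-- The analogue of the transfinite upper central series: every factor consists of all the
elements fixed by the operators modulo the previous term. -/
noncomputable def fixedSeries (φ : B →* MulAut G) : Ordinal.{u} → Subgroup G :=
  OrdinalApprox.lfpApprox ⟨fixedModulo φ, fixedModulo_mono⟩ ⊥

theorem fixedSeries_mono : Monotone (fixedSeries φ) :=
  OrdinalApprox.lfpApprox_mono_right _

theorem fixedSeries_zero : fixedSeries φ 0 = ⊥ :=
  OrdinalApprox.lfpApprox_zero _

theorem fixedSeries_add_one (β : Ordinal.{u}) :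
    fixedSeries φ (β + 1) = fixedModulo φ (fixedSeries φ β) :=
  OrdinalApprox.lfpApprox_add_one _ bot_le β

theorem fixedSeries_of_isSuccLimit {l : Ordinal.{u}} (hl : Order.IsSuccLimit l) :
    fixedSeries φ l = ⨆ β : Set.Iio l, fixedSeries φ β :=
  OrdinalApprox.lfpApprox_of_isSuccLimit _ hl

theorem mem_fixedSeries_of_isSuccLimit {l : Ordinal.{u}} (hl : Order.IsSuccLimit l) {x : G} :
    x ∈ fixedSeries φ l ↔ ∃ β < l, x ∈ fixedSeries φ β := by
  have : Nonempty (Set.Iio l) := ⟨⟨0, hl.bot_lt⟩⟩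
  have hdir : Directed (· ≤ ·) fun β : Set.Iio l => fixedSeries φ β :=
    Monotone.directed_le fun a b hab => fixedSeries_mono hab
  rw [fixedSeries_of_isSuccLimit hl, Subgroup.mem_iSup_of_directed hdir]
  simp

theorem fixedSeries_le_hyperfixedModulo (β : Ordinal.{u}) :
    fixedSeries φ β ≤ hyperfixedModulo φ ⊥ := by
  induction β using Ordinal.limitRecOn with
  | zero => exact fixedSeries_zero.trans_le bot_le
  | add_one β ih =>
    rw [fixedSeries_add_one]
    exact (fixedModulo_mono ih).trans
      ((isFixedClosed_iff isNormalAdmissible_hyperfixedModulo.normal).1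
        isFixedClosed_hyperfixedModulo)
  | limit l hl ih =>
    rw [fixedSeries_of_isSuccLimit hl]
    exact iSup_le fun β => ih β β.2

theorem isNormalAdmissible_fixedSeries (hφ : InnNormalized φ) (β : Ordinal.{u}) :
    IsNormalAdmissible φ (fixedSeries φ β) := by
  induction β using Ordinal.limitRecOn with
  | zero =>
    rw [fixedSeries_zero]
    exact .bot
  | add_one β ih =>
    rw [fixedSeries_add_one]
    exact ih.fixedModulo hφ
  | limit l hl ih =>
    rw [fixedSeries_of_isSuccLimit hl]
    refine .sSup_of_isChain ⟨_, ⟨⟨0, hl.bot_lt⟩, rfl⟩⟩ ?_ ?_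
    · exact Monotone.isChain_range fun _ _ h => fixedSeries_mono h
    · rintro _ ⟨β, rfl⟩
      exact ih β β.2

theorem exists_fixedSeries_eq_hyperfixedModulo (hφ : InnNormalized φ) :
    ∃ τ, fixedSeries φ τ = hyperfixedModulo φ ⊥ := by
  let f : Subgroup G →o Subgroup G := ⟨fixedModulo φ, fixedModulo_mono⟩
  obtain ⟨τ, hτ⟩ : ∃ τ, fixedModulo φ (fixedSeries φ τ) = fixedSeries φ τ :=
    ⟨_, Function.mem_fixedPoints_iff.1 (OrdinalApprox.lfpApprox_ord_mem_fixedPoint f bot_le)⟩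
  have hN := isNormalAdmissible_fixedSeries hφ τ
  exact ⟨τ, (fixedSeries_le_hyperfixedModulo τ).antisymm
    (hyperfixedModulo_le hN ((isFixedClosed_iff hN.normal).2 hτ.le) bot_le)⟩

theorem exists_stabilized_series (hφ : InnNormalized φ) :
    ∃ (τ : Ordinal.{u}) (S : Ordinal.{u} → Subgroup G),
      IsAscendingNormalSeries S τ (hyperfixedModulo φ ⊥) ∧ Stabilizes φ S τ := by
  obtain ⟨τ, hτ⟩ := exists_fixedSeries_eq_hyperfixedModulo hφ
  have hN := isNormalAdmissible_fixedSeries hφ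
  refine ⟨τ, fixedSeries φ, ⟨fun β _ => (hN β).normal, fun β γ h _ => fixedSeries_mono h,
    fixedSeries_zero, hτ, fun l _ hl x => mem_fixedSeries_of_isSuccLimit hl⟩, fun β _ b g hg => ?_⟩
  rw [fixedSeries_add_one] at hg
  exact (mem_fixedModulo (hN β).normal).1 hg b

end FixedSeries

section AscendingSeries

variable {G B : Type u} [Group G] [Group B] {φ : B →* MulAut G} {τ : Ordinal.{u}}
  {S : Ordinal.{u} → Subgroup G} {E : Set Ordinal.{u}} {K N : Subgroup G}

namespace IsAscendingNormalSeries

theorem le_of_isFixedClosed (hS : IsAscendingNormalSeries S τ K) (hN : IsFixedClosed φ N)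
    {β : Ordinal.{u}} (hβ : S β ≤ N) (γ : Ordinal.{u}) (hγ : γ ≤ τ) (hβγ : β ≤ γ)
    (htriv : ∀ δ, β ≤ δ → δ < γ → ActsTriviallyOnFactor φ S δ) : S γ ≤ N := by
  induction γ using Ordinal.limitRecOn with
  | zero => rwa [← le_antisymm hβγ bot_le]
  | add_one γ ih =>
    rcases hβγ.eq_or_lt with rfl | h
    · exact hβ
    have hβγ := Order.lt_add_one_iff.1 h
    have hle : S γ ≤ N := ih ((Order.add_one_le_iff.1 hγ).le) hβγ fun δ h₁ h₂ =>
      htriv δ h₁ (h₂.trans (lt_add_one γ))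
    exact fun x hx => hN x fun b => hle (htriv γ hβγ (lt_add_one γ) b x hx)
  | limit γ hγl ih =>
    rcases hβγ.eq_or_lt with rfl | h
    · exact hβ
    intro x hx
    obtain ⟨δ, hδ, hx⟩ := (hS.limit γ hγ hγl x).1 hx
    have hlt : max δ β < γ := max_lt hδ h
    exact ih _ hlt (hlt.le.trans hγ) (le_max_right _ _) (fun ε h₁ h₂ => htriv ε h₁ (h₂.trans hlt))
      (hS.mono δ _ (le_max_left _ _) (hlt.le.trans hγ) hx)

theorem isNormalAdmissible (hS : IsAscendingNormalSeries S τ K) {β : Ordinal.{u}} (hβ : β < τ)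
    (h : ActsTriviallyOnFactor φ S β) : IsNormalAdmissible φ (S β) where
  normal := hS.normal β hβ.le
  admissible := isAdmissible_of_inv_mul_apply_mem fun x hx b =>
    h b x (hS.mono β (β + 1) (le_add_of_nonneg_right zero_le_one) (Order.add_one_le_of_lt hβ) hx)

end IsAscendingNormalSeries

theorem exists_lt_forall_notMem_of_finite {l : Ordinal.{u}} (hl : Order.IsSuccLimit l)
    (hE : E.Finite) : ∃ β < l, ∀ δ, β ≤ δ → δ < l → δ ∉ E := by
  have hEl : (E ∩ Set.Iio l).Finite := hE.inter_of_left _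
  refine ⟨hEl.toFinset.sup Order.succ, (Finset.sup_lt_iff hl.bot_lt).2 fun δ hδ =>
    hl.succ_lt (hEl.mem_toFinset.1 hδ).2, fun δ hδ hδl hδE => ?_⟩
  have hsup := Finset.le_sup (f := Order.succ) (hEl.mem_toFinset.2 ⟨hδE, hδl⟩)
  exact (Order.succ_le_iff.1 (hsup.trans hδ)).false

variable {R : Subgroup B}

theorem IsAscendingNormalSeries.exists_isFiniteRelIndex_of_actsTrivially (hφ : InnNormalized φ)
    (hφR : InnNormalized (φ.comp R.subtype)) (hR : IsFiniteResidual MulAut.conj R)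
    (hS : IsAscendingNormalSeries S τ K) {β γ : Ordinal.{u}} (hβγ : β < γ) (hγ : γ ≤ τ)
    (htriv : ∀ δ, β ≤ δ → δ < γ → ActsTriviallyOnFactor φ S δ)
    (h : ∃ L, IsNormalAdmissible φ L ∧ Finite L ∧ (hyperfixedModulo φ L).IsFiniteRelIndex (S β)) :
    ∃ L, IsNormalAdmissible φ L ∧ Finite L ∧ (hyperfixedModulo φ L).IsFiniteRelIndex (S γ) := by
  obtain ⟨L, hL, hLfin, hrel⟩ := h
  obtain ⟨L', hL', hL'fin, hle⟩ := hR.finiteByHyperfixed hφ hφR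
    (hS.isNormalAdmissible (hβγ.trans_le hγ) (htriv β le_rfl hβγ)) hL
  have hle' : S γ ≤ hyperfixedModulo φ L' :=
    hS.le_of_isFixedClosed isFixedClosed_hyperfixedModulo hle γ hγ hβγ.le htriv
  exact ⟨L', hL', hL'fin, ⟨by rw [Subgroup.relIndex_eq_one.2 hle']; exact one_ne_zero⟩⟩

theorem IsAscendingNormalSeries.exists_isFiniteRelIndex (hφ : InnNormalized φ)
    (hφR : InnNormalized (φ.comp R.subtype)) (hR : IsFiniteResidual MulAut.conj R)
    (hS : IsAscendingNormalSeries S τ K) (hE : E.Finite)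
    (hfin : ∀ β < τ, β ∈ E → FactorFinite S β)
    (htriv : ∀ β < τ, β ∉ E → ActsTriviallyOnFactor φ S β) (β : Ordinal.{u}) (hβ : β ≤ τ) :
    ∃ L, IsNormalAdmissible φ L ∧ Finite L ∧ (hyperfixedModulo φ L).IsFiniteRelIndex (S β) := by
  induction β using Ordinal.limitRecOn with
  | zero =>
    refine ⟨⊥, .bot, inferInstance, ⟨?_⟩⟩
    rw [hS.zero, Subgroup.relIndex_bot_right]
    exact one_ne_zero
  | add_one β ih =>
    have hlt := Order.add_one_le_iff.1 hβ
    by_cases hβE : β ∈ E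
    · obtain ⟨L, hL, hLfin, hrel⟩ := ih hlt.le
      have hfactor : (S β).relIndex (S (β + 1)) ≠ 0 :=
        (Subgroup.finiteIndex_iff_finite_quotient.2 (hfin β hlt hβE)).index_ne_zero
      exact ⟨L, hL, hLfin, ⟨Subgroup.relIndex_ne_zero_trans hrel.relIndex_ne_zero hfactor⟩⟩
    · exact hS.exists_isFiniteRelIndex_of_actsTrivially hφ hφR hR (lt_add_one β) hβ
        (fun δ h₁ h₂ => htriv δ (h₂.trans_le hβ)
          (h₁.antisymm (Order.lt_add_one_iff.1 h₂) ▸ hβE)) (ih hlt.le)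
  | limit l hl ih =>
    obtain ⟨β, hβl, htail⟩ := exists_lt_forall_notMem_of_finite hl hE
    exact hS.exists_isFiniteRelIndex_of_actsTrivially hφ hφR hR hβl hβ
      (fun δ h₁ h₂ => htriv δ (h₂.trans_le hβ) (htail δ h₁ h₂)) (ih β hβl (hβl.le.trans hβ))

end AscendingSeries

section AutomorphismGroup

variable {G : Type u} [Group G] {A : Subgroup (MulAut G)} {L : Subgroup G}

theorem IsFiniteResidual.innNormalized_comp_subtype (hInn : InnNormalized A.subtype)
    {R : Subgroup A} (hR : IsFiniteResidual MulAut.conj R) :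
    InnNormalized (A.subtype.comp R.subtype) := by
  intro g r
  have hmem : ∀ g, ∀ a ∈ A, MulAut.conj g * a * (MulAut.conj g)⁻¹ ∈ A := fun g a ha => by
    obtain ⟨c, hc⟩ := hInn g ⟨a, ha⟩
    exact hc ▸ c.2
  let f : A →* A := ((MulAut.conj (MulAut.conj g)).toMonoidHom.comp A.subtype).codRestrict A
    fun a => hmem g a a.2
  have hs : Function.Surjective f := fun a =>
    ⟨⟨_, hmem g⁻¹ a a.2⟩, Subtype.ext (by simp [f, mul_assoc])⟩
  exact ⟨⟨f r, hR.apply_mem innNormalized_conj (isSemiEquivariant_conj_of_surjective hs) hs r.2⟩,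
    rfl⟩

theorem IsAdmissible.isInvariantUnder (hL : IsAdmissible A.subtype L) : IsInvariantUnder A L := by
  intro a ha
  ext x
  constructor
  · rintro ⟨y, hy, rfl⟩
    exact hL ⟨a, ha⟩ y hy
  · exact fun hx => ⟨a⁻¹ x, hL ⟨a⁻¹, A.inv_mem ha⟩ x hx, MulAut.apply_inv_self G a x⟩

end AutomorphismGroup

theorem mainTheorem5 {G : Type u} [Group G] (A : Subgroup (MulAut G))
    (hA : IsFiniteByHypercentral A)
    (hInn : ∀ g : G, ∀ a ∈ A, MulAut.conj g * a * (MulAut.conj g)⁻¹ ∈ A)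
    (hseries : ∃ (τ : Ordinal.{u}) (S : Ordinal.{u} → Subgroup G) (E : Set Ordinal.{u}),
      IsAscendingNormalSeries S τ ⊤ ∧ E.Finite ∧
      (∀ β < τ, β ∈ E → FactorFinite S β) ∧
      (∀ β < τ, β ∉ E → ActsTriviallyOnFactor A.subtype S β)) :
    (∃ G₀ : Subgroup G, G₀.Normal ∧ IsInvariantUnder A G₀ ∧ G₀.FiniteIndex ∧
      ∃ (τ : Ordinal.{u}) (S : Ordinal.{u} → Subgroup G),
        IsAscendingNormalSeries S τ G₀ ∧ Stabilizes A.subtype S τ) ∧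
    (∃ (L : Subgroup G) (_ : L.Normal) (hL : IsInvariantUnder A L), Finite L ∧
      ∃ (τ : Ordinal.{u}) (S : Ordinal.{u} → Subgroup (G ⧸ L)),
        IsAscendingNormalSeries S τ ⊤ ∧ Stabilizes (quotientAction A L hL) S τ) := by
  obtain ⟨τ, S, E, hS, hE, hfin, htriv⟩ := hseries
  have hφ : InnNormalized A.subtype := fun g a => ⟨⟨_, hInn g a a.2⟩, rfl⟩
  obtain ⟨R, hR⟩ := hA.finiteByHyperfixed_top.exists_isFiniteResidual
  have hφR := hR.innNormalized_comp_subtype hφ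
  obtain ⟨L₀, hL₀, _, hrel⟩ := hS.exists_isFiniteRelIndex hφ hφR hR hE hfin htriv τ le_rfl
  rw [hS.last] at hrel
  have hG : FiniteByHyperfixed A.subtype ⊤ := hR.finiteByHyperfixed hφ hφR .top hL₀
  have hG₀ := isNormalAdmissible_hyperfixedModulo (φ := A.subtype) (L := ⊥)
  refine ⟨⟨_, hG₀.normal, hG₀.admissible.isInvariantUnder,
    hG.finiteIndex_hyperfixedModulo_bot hφ hR, exists_stabilized_series hφ⟩, ?_⟩
  obtain ⟨L, hL, hLfin, hle⟩ := hG
  have := hL.normal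
  refine ⟨L, hL.normal, hL.admissible.isInvariantUnder, hLfin, ?_⟩
  have hs := QuotientGroup.mk'_surjective L
  have hquot : hyperfixedModulo (quotientOperators A.subtype L hL.admissible) ⊥ = ⊤ :=
    Subgroup.comap_injective hs (by
      rw [comap_hyperfixedModulo_quotientOperators, top_le_iff.1 hle, Subgroup.comap_top])
  rw [← hquot]
  exact exists_stabilized_series ((isSemiEquivariant_mk' _ L hL.admissible).innNormalized hs hφ)
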